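/- Let $X=(X_t)_{t\ge 0}$ be a spectrally negative Lévy process on a probability space $(\Omega,\mathcal F,\mathbb P)$ with $X_0=0$: it has independent and stationary increments and a.s. càdlàg paths without positive jumps, and it is not the negative of a subordinator (its paths are not a.s. non-increasing). Let $(m,\sigma^2,\Pi)$ be its Lévy triplet, with $\Pi$ carried by $(-\infty,0)$, let $\psi(\beta)=\log\mathbb E[e^{\beta X_1}]$ be its Laplace exponent, and for $p>0$ let $\Phi(p)$ be the largest positive solution $\beta$ of $\psi(\beta)=p$. Let $\mathcal T$ be the set of stopping times $\tau:\Omega\to[0,\infty]$ of the augmented natural filtration of $X$. Let $r>0$ with $r>\psi(1)$, $q>0$, $\rho\in[0,1)$, and $U(u)=\frac{u^{1-\rho}-1}{1-\rho}$ for $u>0$. Put $\mathcal O_+=\{(x,s)\in\mathbb R^2: x\le s\}$. For $(x,s)\in\mathcal O_+$ and $c>0$ let $\mathbb P_{x,s}$ be the law under which the log price, again written $X$, starts at $x$ (that is, it is $x$ plus the process above) and $\overline X_t=s\vee\sup_{u\in[0,t]}X_u$. Define $$R^c_t=rt+q\int_0^t\mathbf 1_{\{X_u<\overline X_u-c\}}\,du,\qquad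 V(x,s;c)=\sup_{\tau\in\mathcal T}\mathbb E_{x,s}\big[e^{-R^c_\tau}U(e^{X_\tau})\mathbf 1_{\{\tau<\infty\}}\big],$$ $$\underline v(x)=\sup_{\tau\in\mathcal T}\mathbb E_{x}\big[e^{-(r+q)\tau}U(e^{X_\tau})\mathbf 1_{\{\tau<\infty\}}\big],\qquad \mathcal S_c=\{(x,s)\in\mathcal O_+: V(x,s;c)=U(e^x)\},$$ $$\underline b=\frac1{1-\rho}\log\frac{\Phi(r+q)}{\Phi(r+q)-1+\rho}.$$ Then all the payoffs inside these expectations are integrable and the suprema are finite, and for any $c'>c>0$ $$\underline v(x)\le V(x,s;c)\le V(x,s;c')\qquad\text{for all }(x,s)\in\mathcal O_+,$$ and $$\mathcal S_c\subseteq[\underline b,\infty)^2\cap\mathcal O_+ .$$ -/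

import Mathlib

open MeasureTheory ProbabilityTheory Filter Topology
open scoped NNReal ENNReal

noncomputable section

namespace OmegaSale

/-- A spectrally negative Lévy process started at `0`: a process with independent and stationary
increments whose paths are almost surely right-continuous with left limits and have no positive
jumps, and which is not the negative of a subordinator (its paths are not almost surely
non-increasing). -/
structure IsSpectrallyNegativeLevy {Ω : Type*} [MeasurableSpace Ω] (P : Measure Ω)
    (X : ℝ≥0 → Ω → ℝ) : Prop where
  measurable : ∀ t, Measurable (X t)
  start_zero : ∀ᵐ ω ∂P, X 0 ω = 0
  indep_increments : HasIndepIncrements X P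
  stationary_increments : ∀ s t : ℝ≥0, IdentDistrib (fun ω => X (s + t) ω - X s ω) (X t) P P
  right_continuous : ∀ᵐ ω ∂P, ∀ t, ContinuousWithinAt (fun u => X u ω) (Set.Ici t) t
  left_limit_no_positive_jump : ∀ᵐ ω ∂P, ∀ t, ∃ l : ℝ,
    Tendsto (fun u => X u ω) (𝓝[<] t) (𝓝 l) ∧ X t ω ≤ l
  not_neg_subordinator : ¬ ∀ᵐ ω ∂P, Antitone (fun t => X t ω)

/-- The Lévy–Khintchine exponent of the triplet `(m, σ², ν)`, with `ν` carried by `(-∞, 0)`. -/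
def levyKhintchineExponent (m σ : ℝ) (ν : Measure ℝ) (β : ℂ) : ℂ :=
  m * β + (1 / 2) * (σ : ℂ) ^ 2 * β ^ 2
    + ∫ x in Set.Iio (0 : ℝ),
        (Complex.exp (β * x) - 1 - β * (Set.indicator (Set.Ioi (-1 : ℝ)) (fun y : ℝ => y) x : ℝ)) ∂ν

/-- `(m, σ², ν)` is the Lévy triplet of `X`: the measure `ν` is carried by `(-∞, 0)`, integrates
`1 ∧ x²`, and `E[exp (β X₁)] = exp (Ψ(β))` on the half plane `Re β ≥ 0`, where `Ψ` is the
Lévy–Khintchine exponent of the triplet. (The right-hand side does not vanish, so the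
integrability of `exp (β X₁)` is part of this identity.) -/
structure HasLevyTriplet {Ω : Type*} [MeasurableSpace Ω] (P : Measure Ω) (X : ℝ≥0 → Ω → ℝ)
    (m σ : ℝ) (ν : Measure ℝ) : Prop where
  carrier : ν (Set.Ici 0) = 0
  integrates : ∫⁻ x, ENNReal.ofReal (min 1 (x ^ 2)) ∂ν < ∞
  exponent : ∀ β : ℂ, 0 ≤ β.re →
    ∫ ω, Complex.exp (β * (X 1 ω : ℂ)) ∂P = Complex.exp (levyKhintchineExponent m σ ν β)

/-- The Laplace exponent `ψ(β) = log E[exp (β X₁)]` at a real argument. -/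
def laplaceExponent {Ω : Type*} [MeasurableSpace Ω] (P : Measure Ω) (X : ℝ≥0 → Ω → ℝ)
    (β : ℝ) : ℝ :=
  cgf (X 1) P β

/-- `Φ(p)`: the largest positive solution `β` of `ψ(β) = p`. -/
def rightInverse {Ω : Type*} [MeasurableSpace Ω] (P : Measure Ω) (X : ℝ≥0 → Ω → ℝ)
    (p : ℝ) : ℝ :=
  sSup {β : ℝ | 0 < β ∧ laplaceExponent P X β = p}

/-- The constant filtration generated by the measurable null sets (all null sets, if `P` is
complete). -/
def nullFiltration {Ω : Type*} [mΩ : MeasurableSpace Ω] (P : Measure Ω) :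
    Filtration ℝ≥0 mΩ where
  seq _ := MeasurableSpace.generateFrom {N : Set Ω | MeasurableSet N ∧ P N = 0}
  mono' _ _ _ := le_rfl
  le' _ := MeasurableSpace.generateFrom_le fun _ hN => hN.1

/-- The augmented natural filtration of `X`: at time `t` it is generated by `X u`, `u ≤ t`, and by
the null sets. -/
def augmentedFiltration {Ω : Type*} [mΩ : MeasurableSpace Ω] (P : Measure Ω)
    (X : ℝ≥0 → Ω → ℝ) (hX : ∀ t, Measurable (X t)) : Filtration ℝ≥0 mΩ :=
  Filtration.natural X (fun t => (hX t).stronglyMeasurable) ⊔ nullFiltration P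

/-- The utility function with constant relative risk aversion `ρ`. -/
def crraUtility (ρ u : ℝ) : ℝ :=
  if ρ = 1 then Real.log u else (u ^ (1 - ρ) - 1) / (1 - ρ)

/-- The running maximum `s ∨ sup_{u ≤ t} (x + X u)` of the log price started at `x`, with
starting maximum `s`. -/
def runningMax {Ω : Type*} (X : ℝ≥0 → Ω → ℝ) (x s : ℝ) (t : ℝ≥0) (ω : Ω) : ℝ :=
  max s (⨆ u : Set.Iic t, (x + X u ω))

open Classical in
/-- The Omega clock: `q` times the time spent up to `t` by the log price strictly below its running
maximum minus `c`. -/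
def omegaClock {Ω : Type*} (X : ℝ≥0 → Ω → ℝ) (q c x s : ℝ) (t : ℝ≥0) (ω : Ω) : ℝ :=
  q * ∫ u in (0 : ℝ)..t,
    if x + X u.toNNReal ω < runningMax X x s u.toNNReal ω - c then (1 : ℝ) else 0

/-- The discounting process `R_t = r t + (Omega clock at t)`. -/
def omegaDiscount {Ω : Type*} (X : ℝ≥0 → Ω → ℝ) (r q c x s : ℝ) (t : ℝ≥0) (ω : Ω) : ℝ :=
  r * t + omegaClock X q c x s t ω

/-- The payoff `exp (-D_τ) U(exp (x + X_τ)) 1_{τ < ∞}` of selling at time `τ`, for the discounting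
process `D` and the log price `x + X`. -/
def payoff {Ω : Type*} (X : ℝ≥0 → Ω → ℝ) (ρ x : ℝ) (D : ℝ≥0 → Ω → ℝ)
    (τ : Ω → WithTop ℝ≥0) : Ω → ℝ :=
  Set.indicator {ω | τ ω ≠ ⊤}
    (stoppedValue (fun t ω => Real.exp (-D t ω) * crraUtility ρ (Real.exp (x + X t ω))) τ)

/-- The set of the expected payoffs of all stopping times of the filtration `𝓕`. -/
def expectedPayoffs {Ω : Type*} [mΩ : MeasurableSpace Ω] (P : Measure Ω)
    (𝓕 : Filtration ℝ≥0 mΩ) (X : ℝ≥0 → Ω → ℝ) (ρ x : ℝ) (D : ℝ≥0 → Ω → ℝ) : Set ℝ :=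
  {v | ∃ τ : Ω → WithTop ℝ≥0, IsStoppingTime 𝓕 τ ∧ v = ∫ ω, payoff X ρ x D τ ω ∂P}

/-- The value `V(x, s; c)` of the optimal sale with the Omega clock of tolerance `c`. -/
def saleValue {Ω : Type*} [mΩ : MeasurableSpace Ω] (P : Measure Ω)
    (𝓕 : Filtration ℝ≥0 mΩ) (X : ℝ≥0 → Ω → ℝ) (ρ r q c x s : ℝ) : ℝ :=
  sSup (expectedPayoffs P 𝓕 X ρ x (omegaDiscount X r q c x s))

/-- The value of the optimal sale with the constant discount rate `p`. -/
def constantRateValue {Ω : Type*} [mΩ : MeasurableSpace Ω] (P : Measure Ω)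
    (𝓕 : Filtration ℝ≥0 mΩ) (X : ℝ≥0 → Ω → ℝ) (ρ p x : ℝ) : ℝ :=
  sSup (expectedPayoffs P 𝓕 X ρ x (fun t _ => p * t))

/-- The state space `{(x, s) : x ≤ s}`. -/
def stateSpace : Set (ℝ × ℝ) := {z | z.1 ≤ z.2}

/-- The stopping region of the problem with tolerance `c`. -/
def stoppingRegion {Ω : Type*} [mΩ : MeasurableSpace Ω] (P : Measure Ω)
    (𝓕 : Filtration ℝ≥0 mΩ) (X : ℝ≥0 → Ω → ℝ) (ρ r q c : ℝ) : Set (ℝ × ℝ) :=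
  {z ∈ stateSpace |
    saleValue P 𝓕 X ρ r q c z.1 z.2 - crraUtility ρ (Real.exp z.1) = 0}

/-- The log price threshold `(1 - ρ)⁻¹ log (Φ(p) / (Φ(p) - 1 + ρ))`. -/
def lowerThreshold {Ω : Type*} [MeasurableSpace Ω] (P : Measure Ω) (X : ℝ≥0 → Ω → ℝ)
    (ρ p : ℝ) : ℝ :=
  1 / (1 - ρ) * Real.log (rightInverse P X p / (rightInverse P X p - 1 + ρ))

end OmegaSale

end

/-!
The process may be replaced, off a measurable null set, by a version `Y` all of whose paths are
regular (`exists_isRegularLevy`). The null set lies in the augmented filtration, so stopping times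
and expected payoffs do not change, while `Y` becomes progressively measurable.

*Integrability and finiteness.* The utility of the price `e ^ y` is at most a multiple of
`e ^ y + 2`, and `exp (Y_t - r t)` is a nonnegative supermartingale because `ψ(1) < r`. Its value at
a stopping time therefore has mean at most `1` (`IsRegularLevy.lintegral_stopped_le_one`), which
bounds all payoffs that are discounted at rate `r` at least. All martingale arguments take place on
the grids `(n + 1)⁻¹ ℕ`, where `E[exp (β Y_t)] = exp (ψ(β) t)` follows from independence and
stationarity alone, and are carried to general stopping times by right-continuity.

*Comparison.* The Omega discounting decreases in the tolerance `c` and is at most `(r + q) t`. A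
smaller discounting does not improve each payoff, since the utility may be negative; but a stopping
time may be modified so that it never sells at a negative utility, after which it does
(`IsRegularLevy.sSup_expectedPayoffs_mono`).

*Stopping region.* Let `p = r + q`, `φ = Φ(p)`, and let `b` be the threshold. For `x < b` it pays to
wait until the log price passes `b`. As there are no positive jumps, the log price equals `b` at
that time `T`, and optional stopping of `exp (φ Y_t - p t)` gives `E[exp (-p T)] ≥ exp (-φ (b - x))`
(`IsRegularLevy.one_le_lintegral_passage`). So the value with the constant rate `p`, and all the
more the value with the Omega clock, is at least `U(e ^ b) exp (-φ (b - x))`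
(`IsRegularLevy.le_sSup_expectedPayoffs`). This exceeds `U(e ^ x)`, since `b` strictly
maximizes `U(e ^ b) exp (-φ b)` (`crraUtility_lt_of_lt_threshold`), so it is not
optimal to stop at `x`.
The time `T`, defined by a strict passage, need not be a stopping time of the filtration, which is
not made right-continuous; its roundings up to the grids are.
-/

noncomputable section

namespace OmegaSale

variable {Ω : Type*} [mΩ : MeasurableSpace Ω] {P : Measure Ω}

/-! ### Independence of the augmented past, and a version with regular paths -/

/-- The values at finitely many times before `s` are sums of increments along an increasing sequence
of times from `0` to `s`, hence independent of the increment from `s` to `t`. -/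
theorem indepFun_finset_increment {X : ℝ≥0 → Ω → ℝ} (hm : ∀ t, Measurable (X t))
    (h0 : ∀ᵐ ω ∂P, X 0 ω = 0) (hX : HasIndepIncrements X P) {s t : ℝ≥0} (hst : s ≤ t)
    (I : Finset (Set.Iic s)) :
    IndepFun (fun ω (i : I) => X i ω) (fun ω => X t ω - X s ω) P := by
  classical
  set J : Finset ℝ≥0 := insert 0 (insert s (I.image Subtype.val)) with hJ
  have hJs : ∀ u ∈ J, u ≤ s := by
    intro u hu
    simp only [hJ, Finset.mem_insert, Finset.mem_image] at hu
    rcases hu with rfl | rfl | ⟨v, -, rfl⟩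
    exacts [zero_le, le_rfl, v.2]
  obtain ⟨n, hn⟩ : ∃ n, J.card = n + 1 :=
    Nat.exists_eq_add_one.2 (Finset.card_pos.2 ⟨0, by simp [hJ]⟩)
  set e := J.orderIsoOfFin hn
  set u : ℕ → ℝ≥0 := fun k => if h : k < n + 1 then (e ⟨k, h⟩ : ℝ≥0) else t with hu
  have hun : ∀ v ∈ J, ∃ k, k ≤ n ∧ u k = v := by
    intro v hv
    refine ⟨(e.symm ⟨v, hv⟩ : Fin (n + 1)), Nat.lt_succ_iff.1 (e.symm ⟨v, hv⟩).2, ?_⟩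
    simp only [hu, Fin.is_lt, dif_pos, Fin.eta, OrderIso.apply_symm_apply]
  have humono : Monotone u := by
    intro i j hij
    simp only [hu]
    split_ifs with h1 h2 h2
    · exact e.monotone (by simpa using hij)
    · exact (hJs _ (e _).2).trans hst
    · omega
    · exact le_rfl
  have hu0 : u 0 = 0 := by
    obtain ⟨k, -, hk⟩ := hun 0 (by simp [hJ])
    exact le_antisymm (hk ▸ humono (Nat.zero_le k)) zero_le
  have hus : u n = s := by
    obtain ⟨k, hkn, hk⟩ := hun s (by simp [hJ])
    refine le_antisymm ?_ (hk ▸ humono hkn)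
    simp only [hu, Nat.lt_succ_self, dif_pos]
    exact hJs _ (e _).2
  have hut : u (n + 1) = t := by simp [hu]
  have hI : ∀ i : I, ∃ k, k ≤ n ∧ u k = i := fun i =>
    hun i (by
      simp only [hJ, Finset.mem_insert, Finset.mem_image]
      exact Or.inr (Or.inr ⟨i, i.2, rfl⟩))
  choose k hkn hk using hI
  have hind := (hX.nat humono).indepFun_finset₀ (Finset.range n) {n} (by simp)
    (fun i => ((hm _).sub (hm _)).aemeasurable)
  have hφ : Measurable fun (z : Finset.range n → ℝ) (i : I) =>
      ∑ j : Finset.range n, if (j : ℕ) < k i then z j else 0 := by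
    refine measurable_pi_lambda _ fun i => Finset.measurable_sum _ fun j _ => ?_
    split_ifs
    · exact measurable_pi_apply j
    · exact measurable_const
  have hψ : Measurable fun z : ({n} : Finset ℕ) → ℝ => z ⟨n, by simp⟩ := measurable_pi_apply _
  have hcomp := hind.comp hφ hψ
  refine hcomp.congr ?_ ?_
  · filter_upwards [h0] with ω hω
    funext i
    have h1 : ∑ j : Finset.range n,
        (if (j : ℕ) < k i then X (u (j + 1)) ω - X (u j) ω else 0)
        = ∑ j ∈ Finset.range n, if j < k i then X (u (j + 1)) ω - X (u j) ω else 0 :=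
      Finset.sum_coe_sort (Finset.range n)
        (fun j => if j < k i then X (u (j + 1)) ω - X (u j) ω else 0)
    have h2 : (Finset.range n).filter (· < k i) = Finset.range (k i) := by
      ext j
      have := hkn i
      simp only [Finset.mem_filter, Finset.mem_range]
      omega
    simp only [Function.comp_apply]
    rw [h1, ← Finset.sum_filter, h2, Finset.sum_range_sub (fun j => X (u j) ω), hu0, hω, hk i,
      sub_zero]
  · refine Eventually.of_forall fun ω => ?_
    simp only [Function.comp_apply, hus, hut]

/-- The increments of a process with independent increments are independent of the augmented
past: joining the null sets changes a `σ`-algebra only up to null sets. -/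
theorem indep_augmentedFiltration_increment [IsProbabilityMeasure P] {X : ℝ≥0 → Ω → ℝ}
    (hm : ∀ t, Measurable (X t))
    (h0 : ∀ᵐ ω ∂P, X 0 ω = 0) (hX : HasIndepIncrements X P) {s t : ℝ≥0} (hst : s ≤ t) :
    Indep (augmentedFiltration P X hm s)
      (MeasurableSpace.comap (fun ω => X t ω - X s ω) inferInstance) P := by
  have h1 : IndepFun (fun ω (i : Set.Iic s) => X i ω) (fun ω => X t ω - X s ω) P :=
    IndepFun.process_indepFun₀ (fun i => (hm i).aemeasurable) ((hm t).sub (hm s)).aemeasurable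
      (indepFun_finset_increment hm h0 hX hst)
  rw [IndepFun_iff_Indep] at h1
  have hle : (augmentedFiltration P X hm s : MeasurableSpace Ω)
      ≤ eventuallyMeasurableSpace
      (MeasurableSpace.comap (fun ω (i : Set.Iic s) => X i ω) inferInstance) (ae P) := by
    refine sup_le (α := MeasurableSpace Ω) ?_ ?_
    · rw [Filtration.natural_eq_comap]
      exact le_eventuallyMeasurableSpace
    · refine MeasurableSpace.generateFrom_le fun N hN => ?_
      exact ⟨∅, MeasurableSpace.measurableSet_empty _, ae_eq_empty.2 hN.2⟩
  rw [Indep_iff] at h1 ⊢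
  intro A B hA hB
  obtain ⟨A', hA', hAA'⟩ := hle A hA
  rw [measure_congr (hAA'.inter (ae_eq_refl B)), measure_congr hAA']
  exact h1 A' B hA' hB

/-- A spectrally negative Lévy process relative to a filtration, all of whose paths (not only
almost all) start at `0`, are right-continuous, have left limits and no positive jumps, and whose
value at time `1` has finite exponential moments of positive order. -/
structure IsRegularLevy (P : Measure Ω) (𝓕 : Filtration ℝ≥0 mΩ) (Y : ℝ≥0 → Ω → ℝ) : Prop where
  adapted : ∀ t, Measurable[𝓕 t] (Y t)
  start_zero : ∀ ω, Y 0 ω = 0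
  right_continuous : ∀ ω t, ContinuousWithinAt (fun u => Y u ω) (Set.Ici t) t
  no_positive_jump : ∀ ω t, ∃ l : ℝ, Tendsto (fun u => Y u ω) (𝓝[<] t) (𝓝 l) ∧ Y t ω ≤ l
  indep : ∀ s t, s ≤ t →
    Indep (𝓕 s) (MeasurableSpace.comap (fun ω => Y t ω - Y s ω) inferInstance) P
  stationary : ∀ s t : ℝ≥0, IdentDistrib (fun ω => Y (s + t) ω - Y s ω) (Y t) P P
  mgf_ne_zero : ∀ β : ℝ, 0 ≤ β → mgf (Y 1) P β ≠ 0
  not_antitone : ¬ ∀ᵐ ω ∂P, Antitone (fun t => Y t ω)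

/-- Every spectrally negative Lévy process agrees, off a null set, with one that has regular paths
everywhere. The exceptional set may be taken measurable, so it belongs to the augmented
filtration. -/
theorem exists_isRegularLevy [IsProbabilityMeasure P] {X : ℝ≥0 → Ω → ℝ}
    (hX : IsSpectrallyNegativeLevy P X) {m σ : ℝ} {ν : Measure ℝ} (hν : HasLevyTriplet P X m σ ν) :
    ∃ Y : ℝ≥0 → Ω → ℝ, IsRegularLevy P (augmentedFiltration P X hX.measurable) Y ∧
      ∀ᵐ ω ∂P, ∀ t, X t ω = Y t ω := by
  have hgood : ∀ᵐ ω ∂P, X 0 ω = 0 ∧ (∀ t, ContinuousWithinAt (fun u => X u ω) (Set.Ici t) t) ∧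
      ∀ t, ∃ l : ℝ, Tendsto (fun u => X u ω) (𝓝[<] t) (𝓝 l) ∧ X t ω ≤ l := by
    filter_upwards [hX.start_zero, hX.right_continuous, hX.left_limit_no_positive_jump]
      with ω h1 h2 h3 using ⟨h1, h2, h3⟩
  obtain ⟨N, hsub, hN, hPN⟩ := exists_measurable_superset_of_null (ae_iff.1 hgood)
  have hNgood : ∀ ω, ω ∉ N → X 0 ω = 0 ∧
      (∀ t, ContinuousWithinAt (fun u => X u ω) (Set.Ici t) t) ∧
      ∀ t, ∃ l : ℝ, Tendsto (fun u => X u ω) (𝓝[<] t) (𝓝 l) ∧ X t ω ≤ l := by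
    intro ω hω
    by_contra h
    exact hω (hsub h)
  set Y : ℝ≥0 → Ω → ℝ := fun t => Nᶜ.indicator (X t) with hY
  have hYX : ∀ ω, ω ∉ N → ∀ t, Y t ω = X t ω := fun ω hω t =>
    Set.indicator_of_mem (s := Nᶜ) hω _
  have hY0 : ∀ ω, ω ∈ N → ∀ t, Y t ω = 0 := fun ω hω t =>
    Set.indicator_of_notMem (s := Nᶜ) (not_not.2 hω) _
  have hae : ∀ᵐ ω ∂P, ∀ t, X t ω = Y t ω := by
    filter_upwards [measure_eq_zero_iff_ae_notMem.1 hPN] with ω hω t using (hYX ω hω t).symm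
  have hae' : ∀ t, X t =ᵐ[P] Y t := fun t => by filter_upwards [hae] with ω hω using hω t
  have hsubae : ∀ s t, (fun ω => X t ω - X s ω) =ᵐ[P] fun ω => Y t ω - Y s ω := fun s t => by
    filter_upwards [hae] with ω hω using by rw [hω, hω]
  have hYm : ∀ t, Measurable (Y t) := fun t => (hX.measurable t).indicator hN.compl
  refine ⟨Y, ⟨?_, ?_, ?_, ?_, ?_, ?_, ?_, ?_⟩, hae⟩
  · intro t
    have h1 : Measurable[augmentedFiltration P X hX.measurable t] (X t) := by
      refine Measurable.mono (ma := Filtration.natural X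
        (fun t => (hX.measurable t).stronglyMeasurable) t) ?_ ?_ le_rfl
      · exact ((Filtration.stronglyAdapted_natural
          (fun t => (hX.measurable t).stronglyMeasurable)) t).measurable
      · exact le_sup_left (α := MeasurableSpace Ω)
    have h2 : MeasurableSet[augmentedFiltration P X hX.measurable t] N :=
      (le_sup_right (α := MeasurableSpace Ω) : (nullFiltration P t : MeasurableSpace Ω) ≤ _) _
        (MeasurableSpace.measurableSet_generateFrom ⟨hN, hPN⟩)
    exact h1.indicator h2.compl
  · intro ω
    by_cases hω : ω ∈ N
    · exact hY0 ω hω 0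
    · rw [hYX ω hω]; exact (hNgood ω hω).1
  · intro ω t
    by_cases hω : ω ∈ N
    · simp only [hY0 ω hω]; exact continuousWithinAt_const
    · simp only [hYX ω hω]; exact (hNgood ω hω).2.1 t
  · intro ω t
    by_cases hω : ω ∈ N
    · simp only [hY0 ω hω]; exact ⟨0, tendsto_const_nhds, le_rfl⟩
    · simp only [hYX ω hω]; exact (hNgood ω hω).2.2 t
  · intro s t hst
    have h := indep_augmentedFiltration_increment hX.measurable hX.start_zero
      hX.indep_increments hst
    rw [Indep_iff] at h ⊢
    rintro A B hA ⟨C, hC, rfl⟩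
    have hB : (fun ω => Y t ω - Y s ω) ⁻¹' C =ᵐ[P] (fun ω => X t ω - X s ω) ⁻¹' C := by
      filter_upwards [hsubae s t] with ω hω
      exact congrArg (fun z => z ∈ C) hω.symm
    rw [measure_congr ((ae_eq_refl A).inter hB), measure_congr hB]
    exact h A _ hA ⟨C, hC, rfl⟩
  · intro s t
    have h1 : IdentDistrib (fun ω => Y (s + t) ω - Y s ω) (fun ω => X (s + t) ω - X s ω) P P :=
      IdentDistrib.of_ae_eq ((hYm _).sub (hYm _)).aemeasurable (hsubae s (s + t)).symm
    exact (h1.trans (hX.stationary_increments s t)).trans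
      (IdentDistrib.of_ae_eq (hX.measurable t).aemeasurable (hae' t))
  · intro β hβ
    rw [← mgf_congr (hae' 1)]
    have h := hν.exponent β (by simpa using hβ)
    have h2 : ∫ ω, Complex.exp (β * (X 1 ω : ℂ)) ∂P = ((mgf (X 1) P β : ℝ) : ℂ) := by
      rw [mgf, ← integral_complex_ofReal]
      simp
    rw [h2] at h
    intro h3
    rw [h3] at h
    exact Complex.exp_ne_zero _ h.symm
  · intro h
    refine hX.not_neg_subordinator ?_
    filter_upwards [h, hae] with ω h1 h2
    simpa only [h2] using h1

/-! ### Joint measurability, and the Omega clock -/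

/-- The first point of the grid `(n + 1)⁻¹ ℕ` strictly after `t`. -/
def gridTime (n : ℕ) (t : ℝ≥0) : ℝ≥0 := (⌊((n : ℝ≥0) + 1) * t⌋₊ + 1 : ℕ) / ((n : ℝ≥0) + 1)

theorem lt_gridTime (n : ℕ) (t : ℝ≥0) : t < gridTime n t := by
  rw [gridTime, lt_div_iff₀ (by positivity), mul_comm]
  exact_mod_cast Nat.lt_floor_add_one _

theorem gridTime_le (n : ℕ) (t : ℝ≥0) : gridTime n t ≤ t + 1 / ((n : ℝ≥0) + 1) := by
  have h : (t + 1 / ((n : ℝ≥0) + 1)) * ((n : ℝ≥0) + 1) = ((n : ℝ≥0) + 1) * t + 1 := by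
    field_simp
  rw [gridTime, div_le_iff₀ (by positivity), h]
  push_cast
  gcongr
  exact Nat.floor_le zero_le

theorem tendsto_nhdsGE_of_le_add_grid {t : ℝ≥0} {u : ℕ → ℝ≥0} (h1 : ∀ n, t ≤ u n)
    (h2 : ∀ n : ℕ, u n ≤ t + 1 / ((n : ℝ≥0) + 1)) : Tendsto u atTop (𝓝[≥] t) := by
  refine tendsto_nhdsWithin_iff.2 ⟨?_, Eventually.of_forall h1⟩
  have h0 : Tendsto (fun n : ℕ => t + 1 / ((n : ℝ≥0) + 1)) atTop (𝓝 (t + 0)) :=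
    tendsto_const_nhds.add tendsto_one_div_add_atTop_nhds_zero_nat
  rw [add_zero] at h0
  exact tendsto_of_tendsto_of_tendsto_of_le_of_le tendsto_const_nhds h0 h1 h2

theorem tendsto_gridTime (t : ℝ≥0) : Tendsto (fun n => gridTime n t) atTop (𝓝[≥] t) :=
  tendsto_nhdsGE_of_le_add_grid (fun n => (lt_gridTime n t).le) (fun n => gridTime_le n t)

/-- A process with right-continuous paths is jointly measurable, as the limit of its
approximations from the right along finer and finer grids. -/
theorem measurable_uncurry_of_rightContinuous {α : Type*} [MeasurableSpace α]
    {Z : ℝ≥0 → α → ℝ} (hm : ∀ t, Measurable (Z t))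
    (hr : ∀ a t, ContinuousWithinAt (fun u => Z u a) (Set.Ici t) t) :
    Measurable (fun p : ℝ≥0 × α => Z p.1 p.2) := by
  refine measurable_of_tendsto_metrizable
    (f := fun n (p : ℝ≥0 × α) => Z (gridTime n p.1) p.2) (fun n => ?_) ?_
  · have h1 : Measurable fun p : ℕ × α => Z ((p.1 + 1 : ℕ) / ((n : ℝ≥0) + 1)) p.2 :=
      measurable_from_prod_countable_right fun k =>
        hm ((k + 1 : ℕ) / ((n : ℝ≥0) + 1))
    have h2 : Measurable fun p : ℝ≥0 × α => (⌊((n : ℝ≥0) + 1) * p.1⌋₊, p.2) :=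
      (Nat.measurable_floor.comp (measurable_fst.const_mul _)).prodMk measurable_snd
    exact h1.comp h2
  · rw [tendsto_pi_nhds]
    rintro ⟨t, a⟩
    exact (hr a t).tendsto.comp (tendsto_gridTime t)

theorem IsRegularLevy.measurable {𝓕 : Filtration ℝ≥0 mΩ} {Y : ℝ≥0 → Ω → ℝ}
    (hY : IsRegularLevy P 𝓕 Y) (t : ℝ≥0) : Measurable (Y t) :=
  (hY.adapted t).mono (𝓕.le t) le_rfl

theorem IsRegularLevy.measurable_uncurry {𝓕 : Filtration ℝ≥0 mΩ} {Y : ℝ≥0 → Ω → ℝ}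
    (hY : IsRegularLevy P 𝓕 Y) : Measurable (fun p : ℝ≥0 × Ω => Y p.1 p.2) :=
  measurable_uncurry_of_rightContinuous hY.measurable hY.right_continuous

/-- Up to time `T` the process coincides with the one stopped at `T`, which has right-continuous
paths and is measurable at time `T`. -/
theorem IsRegularLevy.isStronglyProgressive {𝓕 : Filtration ℝ≥0 mΩ} {Y : ℝ≥0 → Ω → ℝ}
    (hY : IsRegularLevy P 𝓕 Y) : IsStronglyProgressive 𝓕 Y := by
  intro T
  have h1 : Measurable[Prod.instMeasurableSpace (m₂ := 𝓕 T)]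
      (fun p : ℝ≥0 × Ω => Y (min T p.1) p.2) := by
    refine @measurable_uncurry_of_rightContinuous Ω (𝓕 T) (fun t => Y (min T t))
      (fun t => (hY.adapted _).mono (𝓕.mono (min_le_left _ _)) le_rfl) fun ω t => ?_
    exact ContinuousWithinAt.comp (t := Set.Ici (min T t)) (hY.right_continuous ω (min T t))
      (by fun_prop) fun u hu => min_le_min_left T hu
  have h2 : Measurable[Prod.instMeasurableSpace (m₂ := 𝓕 T)]
      (fun p : Set.Iic T × Ω => Y (min T p.1) p.2) :=
    h1.comp ((measurable_subtype_coe.comp measurable_fst).prodMk measurable_snd)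
  have h3 : (fun p : Set.Iic T × Ω => Y p.1 p.2) = fun p => Y (min T p.1) p.2 := by
    funext p
    rw [min_eq_right p.1.2]
  rw [h3]
  exact h2.stronglyMeasurable

theorem measurable_stoppedValue_of_uncurry {𝓕 : Filtration ℝ≥0 mΩ} {Z : ℝ≥0 → Ω → ℝ}
    (hZ : Measurable (fun p : ℝ≥0 × Ω => Z p.1 p.2)) {τ : Ω → WithTop ℝ≥0}
    (hτ : IsStoppingTime 𝓕 τ) : Measurable (stoppedValue Z τ) :=
  hZ.comp (hτ.measurable'.untopA.prodMk measurable_id)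

theorem exists_Ico_lt {f : ℝ≥0 → ℝ} {t : ℝ≥0} (hf : ContinuousWithinAt f (Set.Ici t) t) {a : ℝ}
    (ha : a < f t) : ∃ w, t < w ∧ ∀ z, t ≤ z → z < w → a < f z := by
  have h := hf.eventually (lt_mem_nhds ha)
  obtain ⟨w, hw, hsub⟩ := (mem_nhdsGE_iff_exists_Ico_subset' (lt_add_one t)).1 h
  exact ⟨w, hw, fun z h1 h2 => hsub ⟨h1, h2⟩⟩

/-- The supremum of a right-continuous function over `[0, t]`, through countably many times that
depend measurably on `t`. Both sides are the junk value `0` if the function is unbounded. -/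
theorem iSup_Iic_eq_iSup_rat {f : ℝ≥0 → ℝ} (hf : ∀ t, ContinuousWithinAt f (Set.Ici t) t)
    (t : ℝ≥0) :
    ⨆ u : Set.Iic t, f u = ⨆ q : {q : ℚ // Real.toNNReal q ≤ 1}, f (Real.toNNReal q * t) := by
  have hne : Nonempty {q : ℚ // Real.toNNReal q ≤ 1} := ⟨⟨1, by simp⟩⟩
  have hub : upperBounds (Set.range fun u : Set.Iic t => f u)
      = upperBounds (Set.range fun q : {q : ℚ // Real.toNNReal q ≤ 1} =>
          f (Real.toNNReal q * t)) := by
    ext b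
    simp only [mem_upperBounds, Set.forall_mem_range]
    constructor
    · exact fun h q => h ⟨Real.toNNReal q * t, mul_le_of_le_one_left' q.2⟩
    · rintro h ⟨v, hv⟩
      rcases eq_or_lt_of_le (show v ≤ t from hv) with rfl | hvt
      · simpa using h ⟨1, by simp⟩
      by_contra hb
      obtain ⟨w, hw, hfw⟩ := exists_Ico_lt (hf v) (not_le.1 hb)
      have htpos : 0 < t := zero_le.trans_lt hvt
      obtain ⟨q, -, hq1, hq2⟩ := (NNReal.lt_iff_exists_rat_btwn (v / t) (min w t / t)).1
        ((div_lt_div_iff_of_pos_right htpos).2 (lt_min hw hvt))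
      rw [div_lt_iff₀ htpos] at hq1
      rw [lt_div_iff₀ htpos] at hq2
      have hq3 : Real.toNNReal q ≤ 1 := by
        have := hq2.trans_le (min_le_right w t)
        by_contra h1
        exact absurd this (not_lt.2 (le_mul_of_one_le_left' (not_le.1 h1).le))
      exact absurd (h ⟨q, hq3⟩) (not_le.2 (hfw _ hq1.le (hq2.trans_le (min_le_left w t))))
  by_cases hb : BddAbove (Set.range fun u : Set.Iic t => f u)
  · have hb' : BddAbove (Set.range fun q : {q : ℚ // Real.toNNReal q ≤ 1} =>
        f (Real.toNNReal q * t)) := by rwa [BddAbove, ← hub]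
    have h1 := isLUB_ciSup hb
    have h2 := isLUB_ciSup hb'
    rw [IsLUB, hub] at h1
    exact h1.unique h2
  · have hb' : ¬ BddAbove (Set.range fun q : {q : ℚ // Real.toNNReal q ≤ 1} =>
        f (Real.toNNReal q * t)) := by rwa [BddAbove, ← hub]
    rw [Real.iSup_of_not_bddAbove hb, Real.iSup_of_not_bddAbove hb']

theorem measurable_runningMax {Y : ℝ≥0 → Ω → ℝ} (hY : Measurable (fun p : ℝ≥0 × Ω => Y p.1 p.2))
    (hr : ∀ ω t, ContinuousWithinAt (fun u => Y u ω) (Set.Ici t) t) (x s : ℝ) :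
    Measurable (fun p : ℝ≥0 × Ω => runningMax Y x s p.1 p.2) := by
  have h : (fun p : ℝ≥0 × Ω => runningMax Y x s p.1 p.2) = fun p => max s
      (⨆ q : {q : ℚ // Real.toNNReal q ≤ 1}, (x + Y (Real.toNNReal q * p.1) p.2)) := by
    funext p
    rw [runningMax, iSup_Iic_eq_iSup_rat (f := fun u => x + Y u p.2)
      fun t => continuousWithinAt_const.add (hr p.2 t)]
  rw [h]
  refine measurable_const.max (Measurable.iSup fun q => ?_)
  exact (hY.comp ((measurable_fst.const_mul _).prodMk measurable_snd)).const_add x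

/-- The rate, `0` or `1`, of the Omega clock with `q = 1`. -/
def clockRate {α : Type*} (Y : ℝ≥0 → α → ℝ) (c x s : ℝ) (p : ℝ × α) : ℝ :=
  Set.indicator {p : ℝ × α | x + Y p.1.toNNReal p.2 < runningMax Y x s p.1.toNNReal p.2 - c}
    (fun _ => 1) p

theorem omegaClock_eq {α : Type*} (Y : ℝ≥0 → α → ℝ) (q c x s : ℝ) (t : ℝ≥0) (ω : α) :
    omegaClock Y q c x s t ω = q * ∫ u in (0 : ℝ)..t, clockRate Y c x s (u, ω) := by
  simp only [omegaClock, clockRate, Set.indicator_apply, Set.mem_ofPred_eq]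

theorem clockRate_nonneg {α : Type*} (Y : ℝ≥0 → α → ℝ) (c x s : ℝ) (p : ℝ × α) :
    0 ≤ clockRate Y c x s p :=
  Set.indicator_nonneg (fun _ _ => zero_le_one) p

theorem clockRate_le_one {α : Type*} (Y : ℝ≥0 → α → ℝ) (c x s : ℝ) (p : ℝ × α) :
    clockRate Y c x s p ≤ 1 :=
  Set.indicator_le_self' (fun _ _ => zero_le_one) p

theorem clockRate_anti {α : Type*} (Y : ℝ≥0 → α → ℝ) {c c' : ℝ} (hc : c ≤ c')
    (x s : ℝ) (p : ℝ × α) :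
    clockRate Y c' x s p ≤ clockRate Y c x s p := by
  refine Set.indicator_le_indicator_of_subset (fun p hp => ?_) (fun _ => zero_le_one) p
  simp only [Set.mem_ofPred_eq] at hp ⊢
  linarith

theorem IsRegularLevy.measurable_clockRate {𝓕 : Filtration ℝ≥0 mΩ} {Y : ℝ≥0 → Ω → ℝ}
    (hY : IsRegularLevy P 𝓕 Y) (c x s : ℝ) : Measurable (clockRate Y c x s) := by
  have h0 : Measurable fun p : ℝ × Ω => (p.1.toNNReal, p.2) :=
    (measurable_real_toNNReal.comp measurable_fst).prodMk measurable_snd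
  refine measurable_const.indicator (measurableSet_lt ?_ ?_)
  · exact (hY.measurable_uncurry.comp h0).const_add x
  · exact ((measurable_runningMax hY.measurable_uncurry hY.right_continuous x s).comp
      h0).sub_const c

theorem IsRegularLevy.intervalIntegrable_clockRate {𝓕 : Filtration ℝ≥0 mΩ} {Y : ℝ≥0 → Ω → ℝ}
    (hY : IsRegularLevy P 𝓕 Y) (c x s : ℝ) (ω : Ω) (a b : ℝ) :
    IntervalIntegrable (fun u => clockRate Y c x s (u, ω)) volume a b := by
  refine (intervalIntegrable_const (c := (1 : ℝ))).mono_fun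
    ((hY.measurable_clockRate c x s).comp measurable_prodMk_right).aestronglyMeasurable
    (Eventually.of_forall fun u => ?_)
  simp only [Real.norm_eq_abs, abs_of_nonneg (clockRate_nonneg Y c x s (u, ω)), abs_one]
  exact clockRate_le_one Y c x s (u, ω)

theorem IsRegularLevy.measurable_omegaDiscount {𝓕 : Filtration ℝ≥0 mΩ} {Y : ℝ≥0 → Ω → ℝ}
    (hY : IsRegularLevy P 𝓕 Y) (r q c x s : ℝ) :
    Measurable (fun p : ℝ≥0 × Ω => omegaDiscount Y r q c x s p.1 p.2) := by
  have h : Measurable fun p : ℝ≥0 × Ω => ∫ u in (0 : ℝ)..p.1, clockRate Y c x s (u, p.2) := by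
    refine measurable_uncurry_of_continuous_of_measurable
      (u := fun (t : ℝ≥0) ω => ∫ u in (0 : ℝ)..t, clockRate Y c x s (u, ω)) (fun ω => ?_)
      (fun t => ?_)
    · exact (intervalIntegral.continuous_primitive
        (fun a b => hY.intervalIntegrable_clockRate c x s ω a b) 0).comp NNReal.continuous_coe
    · simp only [intervalIntegral.integral_of_le t.coe_nonneg]
      exact (StronglyMeasurable.integral_prod_right
        (f := fun (ω : Ω) (u : ℝ) => clockRate Y c x s (u, ω))
        ((hY.measurable_clockRate c x s).comp measurable_swap).stronglyMeasurable).measurable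
  simp only [omegaDiscount, omegaClock_eq]
  exact (measurable_fst.coe_nnreal_real.const_mul r).add (h.const_mul q)

theorem le_omegaDiscount {α : Type*} (Y : ℝ≥0 → α → ℝ)
    {q : ℝ} (hq : 0 ≤ q) (r c x s : ℝ) (t : ℝ≥0) (ω : α) :
    r * t ≤ omegaDiscount Y r q c x s t ω := by
  rw [omegaDiscount, omegaClock_eq]
  have h := intervalIntegral.integral_nonneg (μ := volume) t.coe_nonneg
    fun u _ => clockRate_nonneg Y c x s (u, ω)
  have := mul_nonneg hq h
  linarith

theorem IsRegularLevy.omegaDiscount_le {𝓕 : Filtration ℝ≥0 mΩ} {Y : ℝ≥0 → Ω → ℝ}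
    (hY : IsRegularLevy P 𝓕 Y) {q : ℝ} (hq : 0 ≤ q) (r c x s : ℝ) (t : ℝ≥0) (ω : Ω) :
    omegaDiscount Y r q c x s t ω ≤ (r + q) * t := by
  rw [omegaDiscount, omegaClock_eq]
  have h := intervalIntegral.integral_mono_on (μ := volume) t.coe_nonneg
    (hY.intervalIntegrable_clockRate c x s ω 0 t) (intervalIntegrable_const (c := (1 : ℝ)))
    fun u _ => clockRate_le_one Y c x s (u, ω)
  simp only [intervalIntegral.integral_const, sub_zero, smul_eq_mul, mul_one] at h
  have := mul_le_mul_of_nonneg_left h hq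
  linarith

theorem IsRegularLevy.omegaDiscount_anti {𝓕 : Filtration ℝ≥0 mΩ} {Y : ℝ≥0 → Ω → ℝ}
    (hY : IsRegularLevy P 𝓕 Y) {q : ℝ} (hq : 0 ≤ q) {c c' : ℝ} (hc : c ≤ c')
    (r x s : ℝ) (t : ℝ≥0) (ω : Ω) :
    omegaDiscount Y r q c' x s t ω ≤ omegaDiscount Y r q c x s t ω := by
  rw [omegaDiscount, omegaDiscount, omegaClock_eq, omegaClock_eq]
  have h := intervalIntegral.integral_mono_on (μ := volume) t.coe_nonneg
    (hY.intervalIntegrable_clockRate c' x s ω 0 t) (hY.intervalIntegrable_clockRate c x s ω 0 t)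
    fun u _ => clockRate_anti Y hc x s (u, ω)
  have := mul_le_mul_of_nonneg_left h hq
  linarith

/-! ### The exponential martingale on time grids -/

/-- The point `k / (n + 1)` of the `n`-th time grid. -/
def gridPoint (n k : ℕ) : ℝ≥0 := k / ((n : ℝ≥0) + 1)

theorem coe_gridPoint (n k : ℕ) : (gridPoint n k : ℝ) = k / ((n : ℝ) + 1) := by
  simp [gridPoint]

theorem gridPoint_strictMono (n : ℕ) : StrictMono (gridPoint n) := fun _ _ h =>
  (div_lt_div_iff_of_pos_right (by positivity)).2 (by exact_mod_cast h)

theorem gridTime_eq_gridPoint (n : ℕ) (t : ℝ≥0) :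
    gridTime n t = gridPoint n (⌊((n : ℝ≥0) + 1) * t⌋₊ + 1) := rfl

/-- The discounted exponential `exp (β Y_t - a t)` as an extended nonnegative number. -/
def discountedExp {α : Type*} (Y : ℝ≥0 → α → ℝ) (β a : ℝ) (t : ℝ≥0) (ω : α) : ℝ≥0∞ :=
  ENNReal.ofReal (Real.exp (β * Y t ω - a * t))

theorem discountedExp_anti {α : Type*} (Y : ℝ≥0 → α → ℝ) (β : ℝ) {a b : ℝ} (h : a ≤ b) (t : ℝ≥0)
    (ω : α) : discountedExp Y β b t ω ≤ discountedExp Y β a t ω := by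
  have := mul_le_mul_of_nonneg_right h t.coe_nonneg
  exact ENNReal.ofReal_le_ofReal (Real.exp_le_exp.2 (by linarith))

theorem IsRegularLevy.measurable_discountedExp {𝓕 : Filtration ℝ≥0 mΩ} {Y : ℝ≥0 → Ω → ℝ}
    (hY : IsRegularLevy P 𝓕 Y) (β a : ℝ) (t : ℝ≥0) : Measurable (discountedExp Y β a t) :=
  (((hY.measurable t).const_mul β).sub_const _).exp.ennreal_ofReal

section Martingale

variable {𝓕 : Filtration ℝ≥0 mΩ} {Y : ℝ≥0 → Ω → ℝ}

theorem IsRegularLevy.mgf_add (hY : IsRegularLevy P 𝓕 Y) (s t : ℝ≥0) (β : ℝ) :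
    mgf (Y (s + t)) P β = mgf (Y s) P β * mgf (Y t) P β := by
  have hind : IndepFun (Y s) (fun ω => Y (s + t) ω - Y s ω) P := by
    rw [IndepFun_iff_Indep]
    exact indep_of_indep_of_le_left (hY.indep s (s + t) le_self_add) (hY.adapted s).comap_le
  have h1 : Y (s + t) = Y s + fun ω => Y (s + t) ω - Y s ω := by
    funext ω
    simp
  have h2 : mgf (fun ω => Y (s + t) ω - Y s ω) P β = mgf (Y t) P β :=
    congrFun (mgf_congr_identDistrib (hY.stationary s t)) β
  rw [h1, hind.mgf_add' (hY.measurable s).aestronglyMeasurable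
    ((hY.measurable _).sub (hY.measurable s)).aestronglyMeasurable, h2]

theorem IsRegularLevy.mgf_nsmul [IsProbabilityMeasure P]
    (hY : IsRegularLevy P 𝓕 Y) (k : ℕ) (t : ℝ≥0) (β : ℝ) :
    mgf (Y (k * t)) P β = mgf (Y t) P β ^ k := by
  induction k with
  | zero =>
    have : Y 0 = fun _ => 0 := funext hY.start_zero
    simp [this, mgf]
  | succ k ih => rw [Nat.cast_succ, add_mul, one_mul, hY.mgf_add, ih, pow_succ]

/-- At rational times the moment generating function is that of the Laplace exponent: this needs
only the additivity of the exponent, no regularity in time. -/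
theorem IsRegularLevy.mgf_gridPoint [IsProbabilityMeasure P]
    (hY : IsRegularLevy P 𝓕 Y) {β : ℝ} (hβ : 0 ≤ β) (n k : ℕ) :
    mgf (Y (gridPoint n k)) P β = Real.exp (laplaceExponent P Y β * gridPoint n k) := by
  have h1 : mgf (Y 1) P β = mgf (Y (gridPoint n 1)) P β ^ (n + 1) := by
    rw [← hY.mgf_nsmul]
    congr 2
    rw [gridPoint]
    push_cast
    field_simp
  have hpos : 0 < mgf (Y 1) P β := lt_of_le_of_ne mgf_nonneg (hY.mgf_ne_zero β hβ).symm
  have h2 : mgf (Y (gridPoint n 1)) P β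
      = Real.exp (laplaceExponent P Y β / ((n : ℝ) + 1)) := by
    refine (pow_left_inj₀ mgf_nonneg (Real.exp_pos _).le n.succ_ne_zero).1 ?_
    rw [← h1, ← Real.exp_nat_mul]
    push_cast
    rw [mul_div_cancel₀ _ (by positivity), laplaceExponent, cgf, Real.exp_log hpos]
  have h3 : gridPoint n k = k * gridPoint n 1 := by
    simp only [gridPoint, Nat.cast_one]
    ring
  rw [h3, hY.mgf_nsmul, h2, ← Real.exp_nat_mul]
  congr 1
  rw [NNReal.coe_mul, NNReal.coe_natCast, coe_gridPoint]
  push_cast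
  ring

theorem IsRegularLevy.lintegral_exp_increment [IsProbabilityMeasure P]
    (hY : IsRegularLevy P 𝓕 Y) {β : ℝ} (hβ : 0 ≤ β)
    (n : ℕ) {j k : ℕ} (hjk : j ≤ k) :
    ∫⁻ ω, ENNReal.ofReal (Real.exp (β * (Y (gridPoint n k) ω - Y (gridPoint n j) ω))) ∂P
      = ENNReal.ofReal (Real.exp (laplaceExponent P Y β * (gridPoint n k - gridPoint n j))) := by
  obtain ⟨i, rfl⟩ := Nat.exists_eq_add_of_le hjk
  have h1 : gridPoint n (j + i) = gridPoint n j + gridPoint n i := by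
    simp only [gridPoint, Nat.cast_add, add_div]
  have h2 := hY.mgf_gridPoint hβ n i
  have hint : Integrable (fun ω => Real.exp (β * Y (gridPoint n i) ω)) P := by
    by_contra h
    rw [mgf_undef h] at h2
    exact (Real.exp_pos _).ne h2
  have hmeas : Measurable fun y : ℝ => ENNReal.ofReal (Real.exp (β * y)) := by fun_prop
  have h3 := ((hY.stationary (gridPoint n j) (gridPoint n i)).comp hmeas).lintegral_eq
  simp only [Function.comp_apply] at h3
  rw [h1, h3, NNReal.coe_add, add_sub_cancel_left, ← h2, mgf,
    ofReal_integral_eq_lintegral_ofReal hint (Eventually.of_forall fun _ => (Real.exp_pos _).le)]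

/-- The exponential martingale, sampled on a grid. -/
theorem IsRegularLevy.setLIntegral_discountedExp_eq [IsProbabilityMeasure P]
    (hY : IsRegularLevy P 𝓕 Y) {β : ℝ} (hβ : 0 ≤ β)
    (n : ℕ) {j k : ℕ} (hjk : j ≤ k) {A : Set Ω} (hA : MeasurableSet[𝓕 (gridPoint n j)] A) :
    ∫⁻ ω in A, discountedExp Y β (laplaceExponent P Y β) (gridPoint n j) ω ∂P
      = ∫⁻ ω in A, discountedExp Y β (laplaceExponent P Y β) (gridPoint n k) ω ∂P := by
  set ψ := laplaceExponent P Y β with hψ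
  set s := gridPoint n j with hs
  set t := gridPoint n k with ht
  have hst : s ≤ t := (gridPoint_strictMono n).monotone hjk
  have hA' : MeasurableSet A := 𝓕.le s A hA
  set f : Ω → ℝ≥0∞ := A.indicator (discountedExp Y β ψ s) with hf
  set g : Ω → ℝ≥0∞ := fun ω => ENNReal.ofReal (Real.exp (β * (Y t ω - Y s ω))) with hg
  have hfm : Measurable[𝓕 s] f := by
    have h0 : Measurable[𝓕 s] (discountedExp Y β ψ s) := by
      have h : Measurable fun y : ℝ => ENNReal.ofReal (Real.exp (β * y - ψ * s)) := by fun_prop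
      exact h.comp (hY.adapted s)
    exact h0.indicator hA
  have hgm : Measurable[MeasurableSpace.comap (fun ω => Y t ω - Y s ω) inferInstance] g := by
    have h : Measurable fun y : ℝ => ENNReal.ofReal (Real.exp (β * y)) := by fun_prop
    exact h.comp (comap_measurable _)
  have hmul := lintegral_mul_eq_lintegral_mul_lintegral_of_independent_measurableSpace
    (𝓕.le s) (((hY.measurable t).sub (hY.measurable s)).comap_le) (hY.indep s t hst) hfm hgm
  have hgint : ∫⁻ ω, g ω ∂P = ENNReal.ofReal (Real.exp (ψ * (t - s))) :=
    hY.lintegral_exp_increment hβ n hjk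
  have hfin : ENNReal.ofReal (Real.exp (-(ψ * (t - s)))) * ENNReal.ofReal (Real.exp (ψ * (t - s)))
      = 1 := by
    rw [← ENNReal.ofReal_mul (Real.exp_pos _).le, ← Real.exp_add]
    simp
  have hdec : ∀ ω, A.indicator (discountedExp Y β ψ t) ω
      = ENNReal.ofReal (Real.exp (-(ψ * (t - s)))) * (f * g) ω := by
    intro ω
    by_cases hω : ω ∈ A
    · simp only [hf, hg, Pi.mul_apply, Set.indicator_of_mem hω, discountedExp]
      rw [← ENNReal.ofReal_mul (Real.exp_pos _).le, ← ENNReal.ofReal_mul (Real.exp_pos _).le,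
        ← Real.exp_add, ← Real.exp_add]
      congr 2
      ring
    · simp [hf, Set.indicator_of_notMem hω]
  rw [← lintegral_indicator hA', ← lintegral_indicator hA']
  have hgm' : Measurable g := by
    have h : Measurable fun y : ℝ => ENNReal.ofReal (Real.exp (β * y)) := by fun_prop
    exact h.comp ((hY.measurable t).sub (hY.measurable s))
  rw [lintegral_congr hdec, lintegral_const_mul _ ((hfm.mono (𝓕.le s) le_rfl).mul hgm')]
  simp only [Pi.mul_apply]
  rw [hmul, hgint, mul_comm (∫⁻ ω, f ω ∂P), ← mul_assoc, hfin, one_mul]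

theorem IsRegularLevy.lintegral_discountedExp [IsProbabilityMeasure P]
    (hY : IsRegularLevy P 𝓕 Y) {β : ℝ} (hβ : 0 ≤ β)
    (n k : ℕ) :
    ∫⁻ ω, discountedExp Y β (laplaceExponent P Y β) (gridPoint n k) ω ∂P = 1 := by
  have h := hY.setLIntegral_discountedExp_eq hβ n (Nat.zero_le k) (A := Set.univ)
    MeasurableSet.univ
  rw [Measure.restrict_univ] at h
  rw [← h]
  have h0 : gridPoint n 0 = 0 := by simp [gridPoint]
  simp [h0, discountedExp, hY.start_zero]

/-- A stopping time with values in the `n`-th grid, through its index `κ`: the event that it equals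
the `k`-th grid point is known at that time. -/
def IsGridStopping (𝓕 : Filtration ℝ≥0 mΩ) (n : ℕ) (κ : Ω → WithTop ℕ) : Prop :=
  ∀ k : ℕ, MeasurableSet[𝓕 (gridPoint n k)] {ω | κ ω = WithTop.some k}

theorem IsGridStopping.measurableSet {n : ℕ} {κ : Ω → WithTop ℕ} (hκ : IsGridStopping 𝓕 n κ)
    (k : ℕ) : MeasurableSet {ω | κ ω = WithTop.some k} := 𝓕.le _ _ (hκ k)

theorem pairwise_disjoint_eq_coe {α : Type*} (κ : α → WithTop ℕ) :
    Pairwise (Function.onFun Disjoint fun k : ℕ => {ω | κ ω = WithTop.some k}) := by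
  intro i j hij
  refine Set.disjoint_left.2 fun ω h1 h2 => hij ?_
  simp only [Set.mem_ofPred_eq] at h1 h2
  exact WithTop.coe_injective (h1.symm.trans h2)

theorem setOf_ne_top_eq_iUnion {α : Type*} (κ : α → WithTop ℕ) :
    {ω | κ ω ≠ ⊤} = ⋃ k : ℕ, {ω | κ ω = WithTop.some k} := by
  ext ω
  simp only [Set.mem_ofPred_eq, Set.mem_iUnion, WithTop.ne_top_iff_exists]
  exact ⟨fun ⟨k, h⟩ => ⟨k, h.symm⟩, fun ⟨k, h⟩ => ⟨k, h.symm⟩⟩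

theorem setLIntegral_ne_top_eq_tsum {n : ℕ} {κ : Ω → WithTop ℕ}
    (hκ : IsGridStopping 𝓕 n κ) (F : ℕ → Ω → ℝ≥0∞) :
    ∫⁻ ω in {ω | κ ω ≠ ⊤}, F ((κ ω).untopD 0) ω ∂P
      = ∑' k : ℕ, ∫⁻ ω in {ω | κ ω = WithTop.some k}, F k ω ∂P := by
  rw [setOf_ne_top_eq_iUnion, lintegral_iUnion hκ.measurableSet (pairwise_disjoint_eq_coe κ)]
  refine tsum_congr fun k => setLIntegral_congr_fun (hκ.measurableSet k) fun ω hω => ?_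
  rw [Set.mem_ofPred_eq] at hω
  simp only [hω, WithTop.untopD_coe]

theorem compl_setOf_lt_eq_biUnion {α : Type*} (κ : α → WithTop ℕ) (m : ℕ) :
    {ω | WithTop.some m < κ ω}ᶜ = ⋃ k ∈ Finset.range (m + 1), {ω | κ ω = WithTop.some k} := by
  ext ω
  simp only [Set.mem_compl_iff, Set.mem_ofPred_eq, not_lt, Set.mem_iUnion, Finset.mem_range,
    exists_prop]
  cases h : κ ω with
  | top => simp
  | coe k =>
    constructor
    · intro hk
      exact ⟨k, Nat.lt_succ_iff.2 (WithTop.coe_le_coe.1 hk), rfl⟩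
    · rintro ⟨i, hi, hki⟩
      rw [hki]
      exact WithTop.coe_le_coe.2 (Nat.lt_succ_iff.1 hi)

theorem IsGridStopping.measurableSet_lt {n : ℕ} {κ : Ω → WithTop ℕ} (hκ : IsGridStopping 𝓕 n κ)
    (m : ℕ) : MeasurableSet {ω | WithTop.some m < κ ω} := by
  rw [← MeasurableSet.compl_iff, compl_setOf_lt_eq_biUnion]
  exact Finset.measurableSet_biUnion _ fun k _ => hκ.measurableSet k

theorem IsGridStopping.measurable_untopD {n : ℕ} {κ : Ω → WithTop ℕ} (hκ : IsGridStopping 𝓕 n κ) :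
    Measurable fun ω => (κ ω).untopD 0 := by
  refine measurable_to_countable' fun k => ?_
  have h : (fun ω => (κ ω).untopD 0) ⁻¹' {k} = {ω | κ ω = WithTop.some k}
      ∪ ({ω | κ ω ≠ ⊤}ᶜ ∩ {_ω | k = 0}) := by
    ext ω
    simp only [Set.mem_preimage, Set.mem_singleton_iff, Set.mem_union, Set.mem_inter_iff,
      Set.mem_compl_iff, Set.mem_ofPred_eq, not_not]
    cases κ ω with
    | top =>
      rw [WithTop.untopD_top]
      exact ⟨fun h => Or.inr ⟨rfl, h.symm⟩, fun h => h.elim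
        (fun h => absurd h WithTop.top_ne_coe) fun h => h.2.symm⟩
    | coe j =>
      rw [WithTop.untopD_coe]
      exact ⟨fun h => Or.inl (congrArg _ h), fun h => h.elim
        (fun h => WithTop.coe_injective h) fun h => absurd h.1 WithTop.coe_ne_top⟩
  rw [h]
  refine (hκ.measurableSet k).union (MeasurableSet.inter ?_ (MeasurableSet.const _))
  rw [setOf_ne_top_eq_iUnion]
  exact (MeasurableSet.iUnion hκ.measurableSet).compl

theorem IsGridStopping.measurable_apply {n : ℕ} {κ : Ω → WithTop ℕ} (hκ : IsGridStopping 𝓕 n κ)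
    {F : ℕ → Ω → ℝ≥0∞} (hF : ∀ k, Measurable (F k)) :
    Measurable fun ω => F ((κ ω).untopD 0) ω := by
  have h : Measurable fun z : ℕ × Ω => F z.1 z.2 := measurable_from_prod_countable_right hF
  exact h.comp (hκ.measurable_untopD.prodMk measurable_id)

/-- Optional stopping of the exponential martingale at the minimum of a grid stopping time
and a grid point. -/
theorem IsRegularLevy.optionalStopping [IsProbabilityMeasure P] (hY : IsRegularLevy P 𝓕 Y) {β : ℝ}
    (hβ : 0 ≤ β) {n : ℕ} {κ : Ω → WithTop ℕ} (hκ : IsGridStopping 𝓕 n κ) (m : ℕ) :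
    (∑ k ∈ Finset.range (m + 1), ∫⁻ ω in {ω | κ ω = WithTop.some k},
        discountedExp Y β (laplaceExponent P Y β) (gridPoint n k) ω ∂P)
      + ∫⁻ ω in {ω | WithTop.some m < κ ω},
          discountedExp Y β (laplaceExponent P Y β) (gridPoint n m) ω ∂P = 1 := by
  have h1 : ∀ k ∈ Finset.range (m + 1), ∫⁻ ω in {ω | κ ω = WithTop.some k},
        discountedExp Y β (laplaceExponent P Y β) (gridPoint n k) ω ∂P
      = ∫⁻ ω in {ω | κ ω = WithTop.some k},
        discountedExp Y β (laplaceExponent P Y β) (gridPoint n m) ω ∂P :=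
    fun k hk => hY.setLIntegral_discountedExp_eq hβ n
      (Nat.lt_succ_iff.1 (Finset.mem_range.1 hk)) (hκ k)
  rw [Finset.sum_congr rfl h1, ← lintegral_biUnion_finset
    (fun i _ j _ hij => pairwise_disjoint_eq_coe κ hij) (fun k _ => hκ.measurableSet k),
    ← compl_setOf_lt_eq_biUnion, add_comm, lintegral_add_compl _ (hκ.measurableSet_lt m),
    hY.lintegral_discountedExp hβ]

theorem IsRegularLevy.setLIntegral_grid_le_one [IsProbabilityMeasure P]
    (hY : IsRegularLevy P 𝓕 Y) {β a : ℝ} (hβ : 0 ≤ β)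
    (ha : laplaceExponent P Y β ≤ a) {n : ℕ} {κ : Ω → WithTop ℕ} (hκ : IsGridStopping 𝓕 n κ) :
    ∫⁻ ω in {ω | κ ω ≠ ⊤}, discountedExp Y β a (gridPoint n ((κ ω).untopD 0)) ω ∂P ≤ 1 := by
  rw [setLIntegral_ne_top_eq_tsum hκ fun k => discountedExp Y β a (gridPoint n k)]
  refine ENNReal.tsum_le_of_sum_range_le fun m => ?_
  rw [← hY.optionalStopping hβ hκ m]
  refine le_trans ?_ le_self_add
  refine (Finset.sum_le_sum fun k _ => lintegral_mono fun ω =>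
    discountedExp_anti Y β ha _ ω).trans ?_
  exact Finset.sum_le_sum_of_subset (Finset.range_mono m.le_succ)

/-- Rounding up to the next grid point turns an optional time, for which `{τ < s}` is known at
time `s`, into a stopping time. -/
theorem isGridStopping_gridTime {τ : Ω → WithTop ℝ≥0}
    (hτ : ∀ s : ℝ≥0, MeasurableSet[𝓕 s] {ω | τ ω < s}) (n : ℕ) :
    IsGridStopping 𝓕 n fun ω => (τ ω).map fun t => ⌊((n : ℝ≥0) + 1) * t⌋₊ + 1 := by
  intro k
  cases k with
  | zero =>
    convert MeasurableSet.empty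
    refine Set.eq_empty_of_forall_notMem fun ω h => ?_
    simp only [Set.mem_ofPred_eq] at h
    cases hω : τ ω with
    | top => simp [hω] at h
    | coe t =>
      rw [hω, WithTop.map_coe] at h
      exact absurd (WithTop.coe_injective h) (Nat.succ_ne_zero _)
  | succ k =>
    have h1 : {ω | (τ ω).map (fun t => ⌊((n : ℝ≥0) + 1) * t⌋₊ + 1) = WithTop.some (k + 1)}
        = {ω | τ ω < gridPoint n (k + 1)} \ {ω | τ ω < gridPoint n k} := by
      ext ω
      simp only [Set.mem_ofPred_eq, Set.mem_sdiff, not_lt]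
      cases hω : τ ω with
      | top => exact iff_of_false WithTop.top_ne_coe fun h => not_top_lt h.1
      | coe t =>
        rw [WithTop.map_coe, WithTop.coe_lt_coe, WithTop.coe_le_coe]
        have h2 : (WithTop.some (⌊((n : ℝ≥0) + 1) * t⌋₊ + 1) = WithTop.some (k + 1))
            ↔ ⌊((n : ℝ≥0) + 1) * t⌋₊ = k := by
          rw [WithTop.coe_inj]
          omega
        refine h2.trans ?_
        rw [Nat.floor_eq_iff zero_le, gridPoint, gridPoint, lt_div_iff₀ (by positivity),
          div_le_iff₀ (by positivity), mul_comm t, and_comm, Nat.cast_succ]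
    rw [h1]
    exact (hτ _).diff (𝓕.mono ((gridPoint_strictMono n) (Nat.lt_succ_self k)).le _ (hτ _))

/-- A discounted exponential whose rate is at least the Laplace exponent is a nonnegative
supermartingale, so its value at a stopping time has mean at most `1`: discretize the stopping time
from above and use Fatou's lemma. -/
theorem IsRegularLevy.lintegral_stopped_le_one [IsProbabilityMeasure P]
    (hY : IsRegularLevy P 𝓕 Y) {β a : ℝ} (hβ : 0 ≤ β)
    (ha : laplaceExponent P Y β ≤ a) {τ : Ω → WithTop ℝ≥0} (hτ : IsStoppingTime 𝓕 τ) :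
    ∫⁻ ω in {ω | τ ω ≠ ⊤}, discountedExp Y β a (τ ω).untopA ω ∂P ≤ 1 := by
  set κ : ℕ → Ω → WithTop ℕ := fun n ω => (τ ω).map fun t => ⌊((n : ℝ≥0) + 1) * t⌋₊ + 1 with hκ
  have hset : ∀ n, {ω | κ n ω ≠ ⊤} = {ω | τ ω ≠ ⊤} := by
    intro n
    ext ω
    simp only [hκ, Set.mem_ofPred_eq, ne_eq, WithTop.map_eq_top_iff]
  have hmeas : MeasurableSet {ω | τ ω ≠ ⊤} := hτ.measurableSet_eq_top.compl
  have hval : ∀ n ω, τ ω ≠ ⊤ →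
      gridPoint n ((κ n ω).untopD 0) = gridTime n (τ ω).untopA := by
    intro n ω hω
    lift τ ω to ℝ≥0 using hω with t ht
    simp only [hκ, ← ht, gridTime_eq_gridPoint, WithTop.map_coe, WithTop.untopD_coe]
  have hlim : ∀ ω ∈ {ω | τ ω ≠ ⊤}, discountedExp Y β a (τ ω).untopA ω
      ≤ liminf (fun n => discountedExp Y β a (gridPoint n ((κ n ω).untopD 0)) ω) atTop := by
    intro ω hω
    have h1 : Tendsto (fun n => gridPoint n ((κ n ω).untopD 0)) atTop (𝓝[≥] (τ ω).untopA) := by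
      simpa only [hval _ ω hω] using tendsto_gridTime (τ ω).untopA
    have h2 : ContinuousWithinAt (fun t => discountedExp Y β a t ω) (Set.Ici (τ ω).untopA)
        (τ ω).untopA := by
      refine ENNReal.continuous_ofReal.continuousAt.comp_continuousWithinAt
        (Real.continuous_exp.continuousAt.comp_continuousWithinAt ?_)
      exact (continuousWithinAt_const.mul (hY.right_continuous ω _)).sub
        (by fun_prop : Continuous fun t : ℝ≥0 => a * (t : ℝ)).continuousWithinAt
    exact (h2.tendsto.comp h1).liminf_eq.ge
  calc ∫⁻ ω in {ω | τ ω ≠ ⊤}, discountedExp Y β a (τ ω).untopA ω ∂P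
      ≤ ∫⁻ ω in {ω | τ ω ≠ ⊤},
          liminf (fun n => discountedExp Y β a (gridPoint n ((κ n ω).untopD 0)) ω) atTop ∂P :=
        setLIntegral_mono' hmeas hlim
    _ ≤ liminf (fun n => ∫⁻ ω in {ω | τ ω ≠ ⊤},
          discountedExp Y β a (gridPoint n ((κ n ω).untopD 0)) ω ∂P) atTop := by
        refine lintegral_liminf_le' fun n => ?_
        have h1 : Measurable fun p : ℝ≥0 × Ω => discountedExp Y β a p.1 p.2 :=
          ((hY.measurable_uncurry.const_mul β).sub
            (measurable_fst.coe_nnreal_real.const_mul a)).exp.ennreal_ofReal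
        have h2 : Measurable fun ω => gridTime n (τ ω).untopA := by
          have h3 : Measurable (gridTime n) :=
            (measurable_from_top (f := fun k : ℕ => ((k + 1 : ℕ) : ℝ≥0) / ((n : ℝ≥0) + 1))).comp
              (Nat.measurable_floor.comp (measurable_id.const_mul _))
          exact h3.comp hτ.measurable'.untopA
        refine (h1.comp (h2.prodMk measurable_id)).aemeasurable.congr ?_
        filter_upwards [ae_restrict_mem hmeas] with ω hω
        simp only [Function.comp_apply, id_eq, hval n ω hω]
    _ ≤ 1 := by
        refine liminf_le_of_le (by isBoundedDefault) fun b hb => ?_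
        obtain ⟨n, hn⟩ := hb.exists
        refine hn.trans ?_
        rw [← hset n]
        exact hY.setLIntegral_grid_le_one hβ ha (isGridStopping_gridTime hτ.measurableSet_lt n)

end Martingale

/-! ### Payoffs: integrability and comparison -/

theorem crraUtility_exp {ρ : ℝ} (hρ : ρ < 1) (y : ℝ) :
    crraUtility ρ (Real.exp y) = (Real.exp ((1 - ρ) * y) - 1) / (1 - ρ) := by
  rw [crraUtility, if_neg hρ.ne, ← Real.exp_mul, mul_comm]

theorem exp_mul_le_one_add_exp {β : ℝ} (h0 : 0 ≤ β) (h1 : β ≤ 1) (y : ℝ) :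
    Real.exp (β * y) ≤ 1 + Real.exp y := by
  rcases le_total 0 y with hy | hy
  · have : Real.exp (β * y) ≤ Real.exp y := Real.exp_le_exp.2 (mul_le_of_le_one_left hy h1)
    linarith
  · have : Real.exp (β * y) ≤ 1 := Real.exp_le_one_iff.2 (mul_nonpos_of_nonneg_of_nonpos h0 hy)
    linarith [Real.exp_pos y]

theorem abs_crraUtility_exp_le {ρ : ℝ} (hρ0 : 0 ≤ ρ) (hρ : ρ < 1) (y : ℝ) :
    |crraUtility ρ (Real.exp y)| ≤ (Real.exp y + 2) / (1 - ρ) := by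
  have hpos : 0 < 1 - ρ := by linarith
  rw [crraUtility_exp hρ, abs_div, abs_of_pos hpos]
  gcongr
  have h1 := exp_mul_le_one_add_exp hpos.le (by linarith) y
  rw [abs_le]
  constructor <;> linarith [Real.exp_pos ((1 - ρ) * y), Real.exp_pos y]

/-- A jointly measurable discounting process that discounts at rate `r` at least. -/
structure IsDiscounting (r : ℝ) (D : ℝ≥0 → Ω → ℝ) : Prop where
  measurable : Measurable (fun p : ℝ≥0 × Ω => D p.1 p.2)
  le : ∀ t ω, r * t ≤ D t ω

theorem isDiscounting_const_mul {r p : ℝ} (h : r ≤ p) :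
    IsDiscounting r (fun (t : ℝ≥0) (_ : Ω) => p * t) where
  measurable := measurable_fst.coe_nnreal_real.const_mul p
  le t _ := mul_le_mul_of_nonneg_right h t.coe_nonneg

theorem payoff_of_eq_coe {α : Type*} (Y : ℝ≥0 → α → ℝ) (ρ x : ℝ) (D : ℝ≥0 → α → ℝ)
    {τ : α → WithTop ℝ≥0} {ω : α} {t : ℝ≥0} (h : τ ω = WithTop.some t) :
    payoff Y ρ x D τ ω = Real.exp (-D t ω) * crraUtility ρ (Real.exp (x + Y t ω)) := by
  rw [payoff, Set.indicator_of_mem (by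
    rw [Set.mem_ofPred_eq, h]
    exact WithTop.coe_ne_top), stoppedValue, h]
  rfl

theorem payoff_of_eq_top {α : Type*} (Y : ℝ≥0 → α → ℝ) (ρ x : ℝ) (D : ℝ≥0 → α → ℝ)
    {τ : α → WithTop ℝ≥0} {ω : α} (h : τ ω = ⊤) : payoff Y ρ x D τ ω = 0 :=
  Set.indicator_of_notMem (by simp [h]) _

section Payoff

variable {𝓕 : Filtration ℝ≥0 mΩ} {Y : ℝ≥0 → Ω → ℝ}

theorem IsRegularLevy.measurable_payoff (hY : IsRegularLevy P 𝓕 Y) {ρ : ℝ} (hρ : ρ < 1) (x : ℝ)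
    {r : ℝ} {D : ℝ≥0 → Ω → ℝ} (hD : IsDiscounting r D) {τ : Ω → WithTop ℝ≥0}
    (hτ : IsStoppingTime 𝓕 τ) : Measurable (payoff Y ρ x D τ) := by
  refine (measurable_stoppedValue_of_uncurry (𝓕 := 𝓕) ?_ hτ).indicator
    hτ.measurableSet_eq_top.compl
  simp only [crraUtility_exp hρ]
  exact hD.measurable.neg.exp.mul
    (((((hY.measurable_uncurry.const_add x).const_mul _).exp).sub_const 1).div_const _)

theorem IsRegularLevy.lintegral_payoff_le [IsProbabilityMeasure P]
    (hY : IsRegularLevy P 𝓕 Y) {ρ : ℝ} (hρ0 : 0 ≤ ρ)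
    (hρ : ρ < 1) (x : ℝ) {r : ℝ} (hr : 0 ≤ r) (hψ : laplaceExponent P Y 1 ≤ r)
    {D : ℝ≥0 → Ω → ℝ} (hD : IsDiscounting r D) {τ : Ω → WithTop ℝ≥0}
    (hτ : IsStoppingTime 𝓕 τ) :
    ∫⁻ ω, ‖payoff Y ρ x D τ ω‖ₑ ∂P ≤ ENNReal.ofReal ((Real.exp x + 2) / (1 - ρ)) := by
  have hpos : 0 < 1 - ρ := by linarith
  have hmeas : MeasurableSet {ω | τ ω ≠ ⊤} := hτ.measurableSet_eq_top.compl
  set C := ENNReal.ofReal (Real.exp x / (1 - ρ)) with hC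
  set C' := ENNReal.ofReal (2 / (1 - ρ)) with hC'
  have hbound : ∀ ω, ‖payoff Y ρ x D τ ω‖ₑ ≤
      C * {ω | τ ω ≠ ⊤}.indicator (fun ω => discountedExp Y 1 r (τ ω).untopA ω) ω + C' := by
    intro ω
    cases hω : τ ω with
    | top => simp [payoff_of_eq_top Y ρ x D hω]
    | coe t =>
      rw [payoff_of_eq_coe Y ρ x D hω, Set.indicator_of_mem (by
        rw [Set.mem_ofPred_eq, hω]
        exact WithTop.coe_ne_top), hω]
      change _ ≤ C * discountedExp Y 1 r t ω + C'
      rw [Real.enorm_eq_ofReal_abs, discountedExp, hC, hC',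
        ← ENNReal.ofReal_mul (by positivity), ← ENNReal.ofReal_add (by positivity) (by positivity)]
      refine ENNReal.ofReal_le_ofReal ?_
      have hrt : 0 ≤ r * t := mul_nonneg hr t.coe_nonneg
      have h1 : Real.exp (-D t ω) ≤ Real.exp (-(r * t)) :=
        Real.exp_le_exp.2 (neg_le_neg (hD.le t ω))
      have h2 : Real.exp (-(r * t)) ≤ 1 := Real.exp_le_one_iff.2 (by linarith)
      have h3 : Real.exp (1 * Y t ω - r * t) = Real.exp (Y t ω) * Real.exp (-(r * t)) := by
        rw [← Real.exp_add]
        congr 1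
        ring
      rw [abs_mul, abs_of_pos (Real.exp_pos _), h3]
      calc Real.exp (-D t ω) * |crraUtility ρ (Real.exp (x + Y t ω))|
          ≤ Real.exp (-(r * t)) * ((Real.exp (x + Y t ω) + 2) / (1 - ρ)) :=
            mul_le_mul h1 (abs_crraUtility_exp_le hρ0 hρ _) (abs_nonneg _) (Real.exp_pos _).le
        _ = Real.exp x / (1 - ρ) * (Real.exp (Y t ω) * Real.exp (-(r * t)))
            + Real.exp (-(r * t)) * (2 / (1 - ρ)) := by
            rw [Real.exp_add]
            ring
        _ ≤ _ := by
            gcongr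
            exact mul_le_of_le_one_left (by positivity) h2
  refine (lintegral_mono hbound).trans ?_
  rw [lintegral_add_right _ measurable_const, lintegral_const_mul' _ _ ENNReal.ofReal_ne_top,
    lintegral_indicator hmeas, lintegral_const, measure_univ, mul_one]
  refine (add_le_add_left (mul_le_mul_right
    (hY.lintegral_stopped_le_one zero_le_one hψ hτ) C) C').trans ?_
  rw [mul_one, hC, hC', ← ENNReal.ofReal_add (by positivity) (by positivity), ← add_div]

theorem IsRegularLevy.integrable_payoff [IsProbabilityMeasure P]
    (hY : IsRegularLevy P 𝓕 Y) {ρ : ℝ} (hρ0 : 0 ≤ ρ)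
    (hρ : ρ < 1) (x : ℝ) {r : ℝ} (hr : 0 ≤ r) (hψ : laplaceExponent P Y 1 ≤ r)
    {D : ℝ≥0 → Ω → ℝ} (hD : IsDiscounting r D) {τ : Ω → WithTop ℝ≥0}
    (hτ : IsStoppingTime 𝓕 τ) : Integrable (payoff Y ρ x D τ) P :=
  ⟨(hY.measurable_payoff hρ x hD hτ).aestronglyMeasurable,
    (hY.lintegral_payoff_le hρ0 hρ x hr hψ hD hτ).trans_lt ENNReal.ofReal_lt_top⟩

theorem IsRegularLevy.bddAbove_expectedPayoffs [IsProbabilityMeasure P]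
    (hY : IsRegularLevy P 𝓕 Y) {ρ : ℝ} (hρ0 : 0 ≤ ρ)
    (hρ : ρ < 1) (x : ℝ) {r : ℝ} (hr : 0 ≤ r) (hψ : laplaceExponent P Y 1 ≤ r)
    {D : ℝ≥0 → Ω → ℝ} (hD : IsDiscounting r D) : BddAbove (expectedPayoffs P 𝓕 Y ρ x D) := by
  refine ⟨(Real.exp x + 2) / (1 - ρ), ?_⟩
  rintro v ⟨τ, hτ, rfl⟩
  have hpos : 0 < 1 - ρ := by linarith
  have h1 := enorm_integral_le_lintegral_enorm (μ := P) (payoff Y ρ x D τ)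
  have h2 := h1.trans (hY.lintegral_payoff_le hρ0 hρ x hr hψ hD hτ)
  rw [Real.enorm_eq_ofReal_abs, ENNReal.ofReal_le_ofReal_iff (by positivity)] at h2
  exact (le_abs_self _).trans h2

theorem expectedPayoffs_nonempty {α : Type*} {mα : MeasurableSpace α} (P : Measure α)
    (𝓕 : Filtration ℝ≥0 mα) (Y : ℝ≥0 → α → ℝ) (ρ x : ℝ) (D : ℝ≥0 → α → ℝ) :
    (expectedPayoffs P 𝓕 Y ρ x D).Nonempty :=
  ⟨_, fun _ => WithTop.some 0, isStoppingTime_const 𝓕 0, rfl⟩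

/-- A smaller discounting gives a larger value. The utility may be negative, and a loss suffers
from a smaller discounting; but a sale at a loss may be replaced by no sale at all. -/
theorem IsRegularLevy.sSup_expectedPayoffs_mono [IsProbabilityMeasure P]
    (hY : IsRegularLevy P 𝓕 Y) {ρ : ℝ} (hρ0 : 0 ≤ ρ)
    (hρ : ρ < 1) (x : ℝ) {r : ℝ} (hr : 0 ≤ r) (hψ : laplaceExponent P Y 1 ≤ r)
    {D D' : ℝ≥0 → Ω → ℝ} (hD : IsDiscounting r D) (hD' : IsDiscounting r D')
    (hDD' : ∀ t ω, D' t ω ≤ D t ω) :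
    sSup (expectedPayoffs P 𝓕 Y ρ x D) ≤ sSup (expectedPayoffs P 𝓕 Y ρ x D') := by
  classical
  refine csSup_le (expectedPayoffs_nonempty P 𝓕 Y ρ x D) ?_
  rintro v ⟨τ, hτ, rfl⟩
  set τ' : Ω → WithTop ℝ≥0 := fun ω => if 0 ≤ x + stoppedValue Y τ ω then τ ω else ⊤ with hτ'
  have hst : IsStoppingTime 𝓕 τ' := by
    intro i
    have h1 := measurableSet_preimage_stoppedValue_inter hY.isStronglyProgressive hτ
      (t := {y : ℝ | 0 ≤ x + y}) (measurableSet_le measurable_const (measurable_const_add x)) i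
    convert h1 using 1
    ext ω
    by_cases h : 0 ≤ x + stoppedValue Y τ ω
    · simp [hτ', h]
    · simp only [hτ', h, if_false, Set.mem_ofPred_eq, Set.mem_inter_iff, Set.mem_preimage,
        false_and, iff_false, not_le]
      exact WithTop.coe_lt_top i
  refine le_trans ?_ (le_csSup (hY.bddAbove_expectedPayoffs hρ0 hρ x hr hψ hD') ⟨τ', hst, rfl⟩)
  refine integral_mono (hY.integrable_payoff hρ0 hρ x hr hψ hD hτ)
    (hY.integrable_payoff hρ0 hρ x hr hψ hD' hst) fun ω => ?_
  have hpos : 0 < 1 - ρ := by linarith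
  cases hω : τ ω with
  | top =>
    have h2 : τ' ω = ⊤ := by simp [hτ', hω]
    rw [payoff_of_eq_top Y ρ x D hω, payoff_of_eq_top Y ρ x D' h2]
  | coe t =>
    have h1 : stoppedValue Y τ ω = Y t ω := by
      rw [stoppedValue, hω]
      rfl
    rw [payoff_of_eq_coe Y ρ x D hω, crraUtility_exp hρ]
    by_cases h : 0 ≤ x + Y t ω
    · have h2 : τ' ω = WithTop.some t := by simp only [hτ', h1, h, if_true, hω]
      rw [payoff_of_eq_coe Y ρ x D' h2, crraUtility_exp hρ]
      refine mul_le_mul_of_nonneg_right (Real.exp_le_exp.2 (neg_le_neg (hDD' t ω))) ?_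
      exact div_nonneg (sub_nonneg.2 (Real.one_le_exp (mul_nonneg hpos.le h))) hpos.le
    · have h2 : τ' ω = ⊤ := by simp only [hτ', h1, h, if_false]
      rw [payoff_of_eq_top Y ρ x D' h2]
      refine mul_nonpos_of_nonneg_of_nonpos (Real.exp_pos _).le
        (div_nonpos_of_nonpos_of_nonneg (sub_nonpos.2 (Real.exp_le_one_iff.2 ?_)) hpos.le)
      exact mul_nonpos_of_nonneg_of_nonpos hpos.le (not_le.1 h).le

end Payoff

/-! ### The Laplace exponent and its right inverse -/

section Exponent

variable {𝓕 : Filtration ℝ≥0 mΩ} {Y : ℝ≥0 → Ω → ℝ}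

theorem IsRegularLevy.increment_nonpos [IsProbabilityMeasure P] (hY : IsRegularLevy P 𝓕 Y)
    (h : ∀ β, 0 ≤ β → laplaceExponent P Y β ≤ 0) (n : ℕ) {j k : ℕ} (hjk : j ≤ k) :
    ∀ᵐ ω ∂P, Y (gridPoint n k) ω ≤ Y (gridPoint n j) ω := by
  set Z : Ω → ℝ := fun ω => Y (gridPoint n k) ω - Y (gridPoint n j) ω with hZ
  have hZm : Measurable Z := (hY.measurable _).sub (hY.measurable _)
  have h1 : ∀ i : ℕ, ∫⁻ ω, ENNReal.ofReal (Real.exp (i * Z ω)) ∂P ≤ 1 := by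
    intro i
    rw [hY.lintegral_exp_increment i.cast_nonneg n hjk, ENNReal.ofReal_le_one,
      Real.exp_le_one_iff]
    have : (gridPoint n j : ℝ) ≤ gridPoint n k :=
      NNReal.coe_le_coe.2 ((gridPoint_strictMono n).monotone hjk)
    exact mul_nonpos_of_nonpos_of_nonneg (h i i.cast_nonneg) (by linarith)
  have hm : ∀ i : ℕ, Measurable fun ω => ENNReal.ofReal (Real.exp (i * Z ω)) := fun i =>
    (hZm.const_mul _).exp.ennreal_ofReal
  have h2 : ∫⁻ ω, liminf (fun i : ℕ => ENNReal.ofReal (Real.exp (i * Z ω))) atTop ∂P ≤ 1 := by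
    refine (lintegral_liminf_le hm).trans (liminf_le_of_le (by isBoundedDefault) fun b hb => ?_)
    obtain ⟨i, hi⟩ := hb.exists
    exact hi.trans (h1 i)
  filter_upwards [ae_lt_top (Measurable.liminf hm) (h2.trans_lt ENNReal.one_lt_top).ne] with ω hω
  by_contra hpos
  have hZpos : 0 < Z ω := by simpa [hZ] using hpos
  have h3 : Tendsto (fun i : ℕ => ENNReal.ofReal (Real.exp (i * Z ω))) atTop (𝓝 ⊤) :=
    ENNReal.tendsto_ofReal_atTop.comp (Real.tendsto_exp_atTop.comp
      (tendsto_natCast_atTop_atTop.atTop_mul_const hZpos))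
  exact hω.ne h3.liminf_eq

/-- If the Laplace exponent were nonpositive then all exponential moments of the increments would
be at most `1`, so the increments would be nonpositive and the process non-increasing. -/
theorem IsRegularLevy.exists_laplaceExponent_pos [IsProbabilityMeasure P]
    (hY : IsRegularLevy P 𝓕 Y) :
    ∃ β, 0 ≤ β ∧ 0 < laplaceExponent P Y β := by
  by_contra hcon
  push Not at hcon
  refine hY.not_antitone ?_
  have h1 : ∀ᵐ ω ∂P, ∀ n j k : ℕ, j ≤ k → Y (gridPoint n k) ω ≤ Y (gridPoint n j) ω := by
    simp only [ae_all_iff]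
    exact fun n j k hjk => hY.increment_nonpos hcon n hjk
  filter_upwards [h1] with ω hω s t hst
  refine le_of_tendsto_of_tendsto' ((hY.right_continuous ω t).tendsto.comp (tendsto_gridTime t))
    ((hY.right_continuous ω s).tendsto.comp (tendsto_gridTime s)) fun n => ?_
  simp only [Function.comp_apply, gridTime_eq_gridPoint]
  refine hω n _ _ (Nat.succ_le_succ (Nat.floor_mono ?_))
  gcongr

theorem IsRegularLevy.integrable_exp (hY : IsRegularLevy P 𝓕 Y) {β : ℝ} (hβ : 0 ≤ β) :
    Integrable (fun ω => Real.exp (β * Y 1 ω)) P := by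
  by_contra h
  exact hY.mgf_ne_zero β hβ (mgf_undef h)

theorem IsRegularLevy.mgf_pos (hY : IsRegularLevy P 𝓕 Y) {β : ℝ} (hβ : 0 ≤ β) :
    0 < mgf (Y 1) P β := lt_of_le_of_ne mgf_nonneg (hY.mgf_ne_zero β hβ).symm

theorem IsRegularLevy.continuousOn_laplaceExponent (hY : IsRegularLevy P 𝓕 Y) :
    ContinuousOn (laplaceExponent P Y) (Set.Ioi 0) := by
  have h1 : Set.Ioi (0 : ℝ) ⊆ interior (integrableExpSet (Y 1) P) :=
    interior_maximal (fun β hβ => hY.integrable_exp (le_of_lt hβ)) isOpen_Ioi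
  exact (continuousOn_mgf.mono h1).log fun β hβ => hY.mgf_ne_zero β (le_of_lt hβ)

/-- The Laplace exponent grows at least linearly, by Jensen's inequality. -/
theorem IsRegularLevy.mul_laplaceExponent_le [IsProbabilityMeasure P]
    (hY : IsRegularLevy P 𝓕 Y) {β l : ℝ} (hβ : 0 ≤ β)
    (hl : 1 ≤ l) : l * laplaceExponent P Y β ≤ laplaceExponent P Y (l * β) := by
  have hl0 : 0 ≤ l := zero_le_one.trans hl
  have hexp : ∀ ω, Real.exp (l * β * Y 1 ω) = Real.exp (β * Y 1 ω) ^ l := by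
    intro ω
    rw [← Real.exp_mul]
    congr 1
    ring
  have h1 : mgf (Y 1) P β ^ l ≤ mgf (Y 1) P (l * β) := by
    have h := (convexOn_rpow hl).map_integral_le (μ := P) (f := fun ω => Real.exp (β * Y 1 ω))
      (Real.continuous_rpow_const hl0).continuousOn isClosed_Ici
      (Eventually.of_forall fun ω => (Real.exp_pos _).le) (hY.integrable_exp hβ) (by
        have := hY.integrable_exp (mul_nonneg hl0 hβ)
        simp only [hexp] at this
        exact this)
    simp only [mgf, hexp]
    exact h
  rw [laplaceExponent, laplaceExponent, cgf, cgf, ← Real.log_rpow (hY.mgf_pos hβ)]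
  exact Real.log_le_log (Real.rpow_pos_of_pos (hY.mgf_pos hβ) l) h1

/-- For `p > ψ(1)` the supremum `Φ(p)` is attained, that is, `ψ(Φ(p)) = p`, and it exceeds `1`. -/
theorem IsRegularLevy.rightInverse_spec [IsProbabilityMeasure P] (hY : IsRegularLevy P 𝓕 Y) {p : ℝ}
    (h1p : laplaceExponent P Y 1 < p) :
    laplaceExponent P Y (rightInverse P Y p) = p ∧ 1 < rightInverse P Y p := by
  obtain ⟨β₀, hβ₀, hψ₀⟩ := hY.exists_laplaceExponent_pos
  have hβ₀pos : 0 < β₀ := by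
    refine lt_of_le_of_ne hβ₀ fun h => ?_
    rw [← h, laplaceExponent, cgf_zero] at hψ₀
    exact lt_irrefl _ hψ₀
  set S : Set ℝ := {β : ℝ | 0 < β ∧ laplaceExponent P Y β = p} with hS
  set ψ₀ := laplaceExponent P Y β₀ with hψ₀def
  -- Beyond `L * β₀` the exponent is larger than `p`.
  set L : ℝ := max (max 1 (1 / β₀)) ((p + 1) / ψ₀) with hL
  have hgrow : ∀ β, L * β₀ ≤ β → p < laplaceExponent P Y β := by
    intro β hβ
    have h1 : L ≤ β / β₀ := (le_div_iff₀ hβ₀pos).2 hβ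
    have h2 := hY.mul_laplaceExponent_le hβ₀
      (((le_max_left _ _).trans (le_max_left _ _)).trans h1)
    rw [div_mul_cancel₀ _ hβ₀pos.ne'] at h2
    have h3 : p + 1 ≤ β / β₀ * ψ₀ := (div_le_iff₀ hψ₀).1 ((le_max_right _ _).trans h1)
    linarith
  have hL1 : 1 ≤ L * β₀ :=
    (div_le_iff₀ hβ₀pos).1 ((le_max_right _ _).trans (le_max_left _ _))
  have hbdd : BddAbove S := by
    refine ⟨L * β₀, fun β hβ => ?_⟩
    by_contra h
    exact (hgrow β (not_le.1 h).le).ne' hβ.2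
  obtain ⟨β₁, hβ₁, hψβ₁⟩ := intermediate_value_Icc hL1
    (hY.continuousOn_laplaceExponent.mono fun β hβ => zero_lt_one.trans_le hβ.1)
    ⟨h1p.le, (hgrow _ le_rfl).le⟩
  have hβ₁1 : 1 < β₁ := lt_of_le_of_ne hβ₁.1 fun h => by
    rw [← h] at hψβ₁
    exact h1p.ne hψβ₁
  have hmem : β₁ ∈ S := ⟨zero_lt_one.trans hβ₁1, hψβ₁⟩
  have hΦ : 1 < rightInverse P Y p := hβ₁1.trans_le (le_csSup hbdd hmem)
  refine ⟨?_, hΦ⟩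
  obtain ⟨u, -, hu, huS⟩ := exists_seq_tendsto_sSup ⟨β₁, hmem⟩ hbdd
  have hcont : ContinuousAt (laplaceExponent P Y) (sSup S) :=
    hY.continuousOn_laplaceExponent.continuousAt (Ioi_mem_nhds (zero_lt_one.trans hΦ))
  refine tendsto_nhds_unique (hcont.tendsto.comp hu) ?_
  exact tendsto_const_nhds.congr fun n => ((huS n).2).symm

end Exponent

/-! ### Passage above a level -/

open Classical in
/-- The first passage time strictly above the level `d`. -/
def passageTime {α : Type*} (Y : ℝ≥0 → α → ℝ) (d : ℝ) (ω : α) : WithTop ℝ≥0 :=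
  if ∃ u, d < Y u ω then WithTop.some (sInf {u | d < Y u ω}) else ⊤

theorem passageTime_lt_iff {α : Type*} (Y : ℝ≥0 → α → ℝ) (d : ℝ) (ω : α) (s : ℝ≥0) :
    passageTime Y d ω < WithTop.some s ↔ ∃ u < s, d < Y u ω := by
  rw [passageTime]
  split_ifs with h
  · have hne : {u | d < Y u ω}.Nonempty := h
    rw [WithTop.coe_lt_coe]
    refine (csInf_lt_iff (OrderBot.bddBelow _) hne).trans ?_
    exact ⟨fun ⟨u, h1, h2⟩ => ⟨u, h2, h1⟩, fun ⟨u, h1, h2⟩ => ⟨u, h2, h1⟩⟩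
  · exact iff_of_false not_top_lt fun ⟨u, _, hu⟩ => h ⟨u, hu⟩

section Passage

variable {𝓕 : Filtration ℝ≥0 mΩ} {Y : ℝ≥0 → Ω → ℝ}

theorem IsRegularLevy.measurableSet_passageTime_lt (hY : IsRegularLevy P 𝓕 Y) (d : ℝ) (s : ℝ≥0) :
    MeasurableSet[𝓕 s] {ω | passageTime Y d ω < s} := by
  have h : {ω | passageTime Y d ω < WithTop.some s}
      = ⋃ q : {q : ℚ // Real.toNNReal q < s}, {ω | d < Y (Real.toNNReal q) ω} := by
    ext ω
    simp only [Set.mem_ofPred_eq, Set.mem_iUnion, passageTime_lt_iff]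
    constructor
    · rintro ⟨u, hus, hu⟩
      obtain ⟨w, huw, hw⟩ := exists_Ico_lt (hY.right_continuous ω u) hu
      obtain ⟨q, -, hq1, hq2⟩ := (NNReal.lt_iff_exists_rat_btwn u (min w s)).1 (lt_min huw hus)
      exact ⟨⟨q, hq2.trans_le (min_le_right _ _)⟩, hw _ hq1.le (hq2.trans_le (min_le_left _ _))⟩
    · rintro ⟨q, hq⟩
      exact ⟨_, q.2, hq⟩
  rw [h]
  refine MeasurableSet.iUnion fun q => ?_
  exact ((hY.adapted _).mono (𝓕.mono q.2.le) le_rfl) measurableSet_Ioi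

/-- Without positive jumps, the level `d` is not exceeded at the passage time itself. -/
theorem IsRegularLevy.le_of_le_passageTime (hY : IsRegularLevy P 𝓕 Y) {d : ℝ} (hd : 0 < d) {ω : Ω}
    {s : ℝ≥0} (h : WithTop.some s ≤ passageTime Y d ω) : Y s ω ≤ d := by
  rcases eq_or_ne s 0 with rfl | hs
  · rw [hY.start_zero]
    exact hd.le
  have hbefore : ∀ u < s, Y u ω ≤ d := fun u hu => not_lt.1 fun hlt =>
    not_lt.2 h ((passageTime_lt_iff Y d ω s).2 ⟨u, hu, hlt⟩)
  obtain ⟨l, hl, hsl⟩ := hY.no_positive_jump ω s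
  have : (𝓝[<] s).NeBot := nhdsLT_neBot_of_exists_lt ⟨0, pos_iff_ne_zero.2 hs⟩
  refine hsl.trans (le_of_tendsto hl ?_)
  filter_upwards [self_mem_nhdsWithin] with u hu using hbefore u hu

/-- Without positive jumps, the process is at the level `d` at the passage time above `d`. -/
theorem IsRegularLevy.apply_passageTime (hY : IsRegularLevy P 𝓕 Y) {d : ℝ} (hd : 0 < d) {ω : Ω}
    {t : ℝ≥0} (h : passageTime Y d ω = WithTop.some t) : Y t ω = d := by
  refine le_antisymm (hY.le_of_le_passageTime hd h.ge) ?_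
  by_contra hlt
  obtain ⟨w, htw, hw⟩ := exists_Ico_lt (f := fun u => -Y u ω) (hY.right_continuous ω t).neg
    (neg_lt_neg (not_le.1 hlt))
  obtain ⟨u, huw, hu⟩ := (passageTime_lt_iff Y d ω w).1 (h ▸ WithTop.coe_lt_coe.2 htw)
  rcases lt_or_ge u t with hut | htu
  · exact absurd ((passageTime_lt_iff Y d ω t).2 ⟨u, hut, hu⟩) (not_lt.2 h.ge)
  · linarith [hw u htu huw]

/-- The index, on the `n`-th grid, of the first grid point after the passage time. -/
def passageIndex {α : Type*} (Y : ℝ≥0 → α → ℝ) (d : ℝ) (n : ℕ) (ω : α) : WithTop ℕ :=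
  (passageTime Y d ω).map fun t => ⌊((n : ℝ≥0) + 1) * t⌋₊ + 1

/-- The first point of the `n`-th grid after the passage time. -/
def gridPassage {α : Type*} (Y : ℝ≥0 → α → ℝ) (d : ℝ) (n : ℕ) (ω : α) : WithTop ℝ≥0 :=
  (passageTime Y d ω).map (gridTime n)

theorem IsRegularLevy.isGridStopping_passageIndex (hY : IsRegularLevy P 𝓕 Y) (d : ℝ) (n : ℕ) :
    IsGridStopping 𝓕 n (passageIndex Y d n) :=
  isGridStopping_gridTime (hY.measurableSet_passageTime_lt d) n

theorem IsRegularLevy.isStoppingTime_gridPassage (hY : IsRegularLevy P 𝓕 Y) (d : ℝ) (n : ℕ) :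
    IsStoppingTime 𝓕 (gridPassage Y d n) := by
  intro i
  have h : {ω | gridPassage Y d n ω ≤ WithTop.some i}
      = ⋃ k : {k : ℕ // gridPoint n k ≤ i}, {ω | passageIndex Y d n ω = WithTop.some (k : ℕ)} := by
    ext ω
    simp only [Set.mem_ofPred_eq, Set.mem_iUnion, gridPassage, passageIndex]
    cases passageTime Y d ω with
    | top =>
      refine iff_of_false (not_le.2 (WithTop.coe_lt_top i)) ?_
      rintro ⟨k, hk⟩
      exact WithTop.top_ne_coe hk
    | coe t =>
      rw [WithTop.map_coe, WithTop.map_coe, WithTop.coe_le_coe]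
      constructor
      · intro ht
        exact ⟨⟨_, ht⟩, rfl⟩
      · rintro ⟨k, hk⟩
        rw [gridTime_eq_gridPoint, WithTop.coe_injective hk]
        exact k.2
  change MeasurableSet[𝓕 i] {ω | gridPassage Y d n ω ≤ WithTop.some i}
  rw [h]
  exact MeasurableSet.iUnion fun k => 𝓕.mono k.2 _ (hY.isGridStopping_passageIndex d n k)

theorem IsRegularLevy.measurableSet_passageTime_ne_top (hY : IsRegularLevy P 𝓕 Y) (d : ℝ) :
    MeasurableSet {ω | passageTime Y d ω ≠ ⊤} := by
  have h : {ω | passageTime Y d ω ≠ ⊤}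
      = ⋃ n : ℕ, {ω | passageTime Y d ω < ((n : ℝ≥0) : WithTop ℝ≥0)} := by
    ext ω
    simp only [Set.mem_ofPred_eq, Set.mem_iUnion]
    cases passageTime Y d ω with
    | top => simp
    | coe t =>
      refine iff_of_true WithTop.coe_ne_top ?_
      obtain ⟨n, hn⟩ := exists_nat_gt t
      exact ⟨n, WithTop.coe_lt_coe.2 hn⟩
  rw [h]
  exact MeasurableSet.iUnion fun n => 𝓕.le _ _ (hY.measurableSet_passageTime_lt d n)

theorem passageIndex_ne_top_iff {α : Type*} (Y : ℝ≥0 → α → ℝ) (d : ℝ) (n : ℕ) (ω : α) :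
    passageIndex Y d n ω ≠ ⊤ ↔ passageTime Y d ω ≠ ⊤ := by
  rw [passageIndex, ne_eq, WithTop.map_eq_top_iff]

theorem gridPoint_passageIndex {α : Type*} (Y : ℝ≥0 → α → ℝ) (d : ℝ) (n : ℕ) {ω : α}
    (h : passageTime Y d ω ≠ ⊤) :
    gridPoint n ((passageIndex Y d n ω).untopD 0) = gridTime n (passageTime Y d ω).untopA := by
  rw [passageIndex]
  lift passageTime Y d ω to ℝ≥0 using h with t ht
  rw [WithTop.map_coe, WithTop.untopD_coe]
  rfl

/-- Truncation `e ≤ min e K + e² / K` of `e = exp (φ Y_t - p t)`, with the square expressed by the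
discounted exponential of parameter `2 φ` up to a factor that is bounded until time `N`. -/
theorem discountedExp_le_min_add {α : Type*} (Y : ℝ≥0 → α → ℝ) {φ p a N K : ℝ} (hp : 0 ≤ p)
    (ha : 0 ≤ a) (hK : 0 < K) {t : ℝ≥0} (htN : (t : ℝ) ≤ N) (ω : α) :
    discountedExp Y φ p t ω ≤ min (discountedExp Y φ p t ω) (ENNReal.ofReal K)
      + ENNReal.ofReal (Real.exp (a * N) / K) * discountedExp Y (2 * φ) a t ω := by
  set e := Real.exp (φ * Y t ω - p * t) with he
  have h1 : discountedExp Y φ p t ω = ENNReal.ofReal e := rfl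
  have hsq : e ^ 2 ≤ Real.exp (a * N) * Real.exp (2 * φ * Y t ω - a * t) := by
    rw [he, ← Real.exp_nat_mul, ← Real.exp_add]
    refine Real.exp_le_exp.2 ?_
    have h2 := mul_nonneg hp t.coe_nonneg
    have h3 := mul_le_mul_of_nonneg_left htN ha
    push_cast
    linarith
  rw [h1, discountedExp, ← ENNReal.ofReal_mul (by positivity), ← ENNReal.ofReal_min,
    ← ENNReal.ofReal_add (by positivity) (by positivity)]
  refine ENNReal.ofReal_le_ofReal ?_
  rw [div_mul_eq_mul_div]
  rcases le_total e K with h | h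
  · rw [min_eq_left h]
    have : 0 ≤ Real.exp (a * N) * Real.exp (2 * φ * Y t ω - a * t) / K := by positivity
    linarith
  · have : e ≤ Real.exp (a * N) * Real.exp (2 * φ * Y t ω - a * t) / K := by
      rw [le_div_iff₀ hK]
      have := mul_le_mul_of_nonneg_left h (Real.exp_pos (φ * Y t ω - p * t)).le
      rw [← he] at this
      linarith [sq e]
    have h2 : 0 ≤ min e K := le_min (Real.exp_pos _).le hK.le
    linarith

/-- If the index exceeds `m` then the passage time is not before the `m`-th grid point, so that the
process is still at most `d` there. -/
theorem IsRegularLevy.setLIntegral_survival_le [IsProbabilityMeasure P] (hY : IsRegularLevy P 𝓕 Y)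
    {φ p d : ℝ} (hφ : 0 ≤ φ) (hd : 0 < d) (n m : ℕ) :
    ∫⁻ ω in {ω | WithTop.some m < passageIndex Y d n ω}, discountedExp Y φ p (gridPoint n m) ω ∂P
      ≤ ENNReal.ofReal (Real.exp (φ * d - p * gridPoint n m)) := by
  calc ∫⁻ ω in {ω | WithTop.some m < passageIndex Y d n ω}, discountedExp Y φ p (gridPoint n m) ω ∂P
      ≤ ∫⁻ _ω in {ω | WithTop.some m < passageIndex Y d n ω},
          ENNReal.ofReal (Real.exp (φ * d - p * gridPoint n m)) ∂P := by
        refine setLIntegral_mono' ((hY.isGridStopping_passageIndex d n).measurableSet_lt m)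
          fun ω hω => ENNReal.ofReal_le_ofReal ?_
        have hle : WithTop.some (gridPoint n m) ≤ passageTime Y d ω := by
          rw [Set.mem_ofPred_eq, passageIndex] at hω
          cases hτ : passageTime Y d ω with
          | top => exact le_top
          | coe t =>
            rw [hτ, WithTop.map_coe, WithTop.coe_lt_coe, Nat.lt_succ_iff] at hω
            rw [WithTop.coe_le_coe, gridPoint, div_le_iff₀ (by positivity), mul_comm]
            exact (Nat.cast_le.2 hω).trans (Nat.floor_le zero_le)
        refine Real.exp_le_exp.2 ?_
        have := mul_le_mul_of_nonneg_left (hY.le_of_le_passageTime hd hle) hφ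
        linarith
    _ ≤ ∫⁻ _ω, ENNReal.ofReal (Real.exp (φ * d - p * gridPoint n m)) ∂P :=
        setLIntegral_le_lintegral _ _
    _ = _ := by simp

/-- Optional stopping at the rounded passage time, up to time `N`. The stopped martingale is
truncated at `K`, at the cost of a term from its second moment, so that the mesh of the grid may
tend to `0` under the integral; the last term bounds the paths that have not passed `d`. -/
theorem IsRegularLevy.one_le_truncated_passage [IsProbabilityMeasure P] (hY : IsRegularLevy P 𝓕 Y)
    {φ p a d K : ℝ} (hφ : 0 < φ) (hp : 0 ≤ p) (hφp : laplaceExponent P Y φ = p) (ha : 0 ≤ a)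
    (hφa : laplaceExponent P Y (2 * φ) ≤ a) (hd : 0 < d) (hK : 0 < K) (N n : ℕ) :
    1 ≤ ∫⁻ ω in {ω | passageTime Y d ω ≠ ⊤},
          min (discountedExp Y φ p (gridTime n (passageTime Y d ω).untopA) ω) (ENNReal.ofReal K) ∂P
        + ENNReal.ofReal (Real.exp (a * N) / K) + ENNReal.ofReal (Real.exp (φ * d - p * N)) := by
  set κ := passageIndex Y d n with hκdef
  have hκ : IsGridStopping 𝓕 n κ := hY.isGridStopping_passageIndex d n
  set m := N * (n + 1) with hm
  have hmN : (gridPoint n m : ℝ) = N := by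
    rw [coe_gridPoint, hm]
    push_cast
    field_simp
  have hset : {ω | passageTime Y d ω ≠ ⊤} = {ω | κ ω ≠ ⊤} :=
    Set.ext fun ω => (passageIndex_ne_top_iff Y d n ω).symm
  have hone := hY.optionalStopping hφ.le hκ m
  rw [hφp] at hone
  rw [← hone]
  refine add_le_add ?_ ?_
  · set C := ENNReal.ofReal (Real.exp (a * N) / K) with hC
    set F : ℕ → Ω → ℝ≥0∞ := fun k ω =>
      min (discountedExp Y φ p (gridPoint n k) ω) (ENNReal.ofReal K)
        + C * discountedExp Y (2 * φ) a (gridPoint n k) ω with hF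
    have hterm : ∀ k ∈ Finset.range (m + 1),
        ∫⁻ ω in {ω | κ ω = WithTop.some k}, discountedExp Y φ p (gridPoint n k) ω ∂P
          ≤ ∫⁻ ω in {ω | κ ω = WithTop.some k}, F k ω ∂P := by
      intro k hk
      refine lintegral_mono fun ω => discountedExp_le_min_add Y hp ha hK ?_ ω
      rw [← hmN]
      exact NNReal.coe_le_coe.2 ((gridPoint_strictMono n).monotone
        (Nat.lt_succ_iff.1 (Finset.mem_range.1 hk)))
    refine (Finset.sum_le_sum hterm).trans ((ENNReal.sum_le_tsum _).trans ?_)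
    rw [← setLIntegral_ne_top_eq_tsum hκ F, ← hset]
    have hmeas := hY.measurableSet_passageTime_ne_top d
    have hcongr : ∫⁻ ω in {ω | passageTime Y d ω ≠ ⊤}, F ((κ ω).untopD 0) ω ∂P
        = ∫⁻ ω in {ω | passageTime Y d ω ≠ ⊤},
          (min (discountedExp Y φ p (gridTime n (passageTime Y d ω).untopA) ω) (ENNReal.ofReal K)
            + C * discountedExp Y (2 * φ) a (gridPoint n ((κ ω).untopD 0)) ω) ∂P :=
      setLIntegral_congr_fun hmeas fun ω hω => by
        simp only [hF, hκdef, gridPoint_passageIndex Y d n hω]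
    have hκm : Measurable fun ω => discountedExp Y (2 * φ) a (gridPoint n ((κ ω).untopD 0)) ω :=
      hκ.measurable_apply fun k => hY.measurable_discountedExp (2 * φ) a (gridPoint n k)
    have hmoment : ∫⁻ ω in {ω | passageTime Y d ω ≠ ⊤},
        C * discountedExp Y (2 * φ) a (gridPoint n ((κ ω).untopD 0)) ω ∂P ≤ C := by
      rw [lintegral_const_mul C hκm, hset]
      exact (mul_le_mul_right (hY.setLIntegral_grid_le_one (mul_nonneg zero_le_two hφ.le) hφa hκ)
        C).trans_eq (mul_one C)
    rw [hcongr]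
    exact (lintegral_add_right _ (hκm.const_mul C)).trans_le (add_le_add_right hmoment _)
  · rw [← hmN]
    exact hY.setLIntegral_survival_le hφ.le hd n m

end Passage

/-! ### The value of waiting for a passage -/

theorem coe_untopA {t : WithTop ℝ≥0} (h : t ≠ ⊤) : WithTop.some t.untopA = t := by
  lift t to ℝ≥0 using h
  rfl

section PassageValue

variable {𝓕 : Filtration ℝ≥0 mΩ} {Y : ℝ≥0 → Ω → ℝ}

theorem IsRegularLevy.tendsto_apply_gridTime (hY : IsRegularLevy P 𝓕 Y) {d : ℝ} (hd : 0 < d)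
    {ω : Ω} (h : passageTime Y d ω ≠ ⊤) :
    Tendsto (fun n => Y (gridTime n (passageTime Y d ω).untopA) ω) atTop (𝓝 d) := by
  have h1 : Y (passageTime Y d ω).untopA ω = d :=
    hY.apply_passageTime hd (coe_untopA h).symm
  have h2 := (hY.right_continuous ω (passageTime Y d ω).untopA).tendsto.comp
    (tendsto_gridTime (passageTime Y d ω).untopA)
  rwa [h1] at h2

theorem tendsto_coe_gridTime (t : ℝ≥0) :
    Tendsto (fun n => (gridTime n t : ℝ)) atTop (𝓝 (t : ℝ)) :=
  (NNReal.tendsto_coe.2 ((tendsto_gridTime t).mono_right nhdsWithin_le_nhds))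

/-- The exponential martingale `exp (φ Y_t - p t)`, with `ψ(φ) = p`, stopped when `Y` passes the
level `d`: the Laplace transform of the passage time is at least `exp (-φ d)`. The overshoot along
the grids disappears in the limit, as the stopped martingales are bounded in `L²` up to a finite
time. -/
theorem IsRegularLevy.one_le_lintegral_passage [IsProbabilityMeasure P] (hY : IsRegularLevy P 𝓕 Y)
    {φ p d : ℝ} (hφ : 0 < φ) (hp : 0 < p) (hφp : laplaceExponent P Y φ = p) (hd : 0 < d) :
    1 ≤ ∫⁻ ω in {ω | passageTime Y d ω ≠ ⊤},
      ENNReal.ofReal (Real.exp (φ * d - p * (passageTime Y d ω).untopA)) ∂P := by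
  set J := ∫⁻ ω in {ω | passageTime Y d ω ≠ ⊤},
      ENNReal.ofReal (Real.exp (φ * d - p * (passageTime Y d ω).untopA)) ∂P with hJ
  set a := max (laplaceExponent P Y (2 * φ)) 0 with ha
  have hmeas := hY.measurableSet_passageTime_ne_top d
  -- The mesh of the grid tends to `0`, with the truncation `K` and the time `N` fixed.
  have hstep1 : ∀ (K : ℝ), 0 < K → ∀ N : ℕ,
      1 ≤ J + ENNReal.ofReal (Real.exp (a * N) / K)
        + ENNReal.ofReal (Real.exp (φ * d - p * N)) := by
    intro K hK N
    have hlim : Tendsto (fun n => ∫⁻ ω in {ω | passageTime Y d ω ≠ ⊤},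
        min (discountedExp Y φ p (gridTime n (passageTime Y d ω).untopA) ω)
          (ENNReal.ofReal K) ∂P) atTop
        (𝓝 (∫⁻ ω in {ω | passageTime Y d ω ≠ ⊤},
          min (ENNReal.ofReal (Real.exp (φ * d - p * (passageTime Y d ω).untopA)))
            (ENNReal.ofReal K) ∂P)) := by
      refine tendsto_lintegral_of_dominated_convergence' (fun _ => ENNReal.ofReal K) (fun n => ?_)
        (fun n => Eventually.of_forall fun ω => min_le_right _ _) ?_ ?_
      · have h1 : Measurable fun ω => min (discountedExp Y φ p
            (gridPoint n ((passageIndex Y d n ω).untopD 0)) ω) (ENNReal.ofReal K) :=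
          ((hY.isGridStopping_passageIndex d n).measurable_apply fun k =>
            hY.measurable_discountedExp φ p (gridPoint n k)).min measurable_const
        refine h1.aemeasurable.congr ?_
        filter_upwards [ae_restrict_mem hmeas] with ω hω
        rw [gridPoint_passageIndex Y d n hω]
      · rw [lintegral_const]
        exact ENNReal.mul_ne_top ENNReal.ofReal_ne_top (measure_ne_top _ _)
      · filter_upwards [ae_restrict_mem hmeas] with ω hω
        refine Tendsto.min ?_ tendsto_const_nhds
        exact ENNReal.tendsto_ofReal ((Real.continuous_exp.tendsto _).comp
          (((hY.tendsto_apply_gridTime hd hω).const_mul φ).sub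
            ((tendsto_coe_gridTime _).const_mul p)))
    refine (ge_of_tendsto' ((hlim.add_const _).add_const _) fun n =>
      hY.one_le_truncated_passage hφ hp.le hφp (le_max_right _ _) (le_max_left _ _) hd hK N n).trans
      ?_
    gcongr
    exact lintegral_mono fun ω => min_le_left _ _
  -- The truncation is removed; then `N` tends to infinity.
  have hstep2 : ∀ N : ℕ, 1 ≤ J + ENNReal.ofReal (Real.exp (φ * d - p * N)) := by
    intro N
    have h0 : Tendsto (fun k : ℕ => ENNReal.ofReal (Real.exp (a * N) / ((k : ℝ) + 1))) atTop
        (𝓝 0) := by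
      rw [← ENNReal.ofReal_zero]
      have := (tendsto_one_div_add_atTop_nhds_zero_nat (𝕜 := ℝ)).const_mul (Real.exp (a * N))
      simp only [mul_zero, mul_one_div] at this
      exact ENNReal.tendsto_ofReal this
    have h1 := (h0.const_add J).add_const (ENNReal.ofReal (Real.exp (φ * d - p * N)))
    rw [add_zero] at h1
    exact ge_of_tendsto' h1 fun k => hstep1 _ (by positivity) N
  have h0 : Tendsto (fun N : ℕ => ENNReal.ofReal (Real.exp (φ * d - p * N))) atTop (𝓝 0) := by
    rw [← ENNReal.ofReal_zero]
    refine ENNReal.tendsto_ofReal (Real.tendsto_exp_atBot.comp ?_)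
    exact tendsto_atBot_add_const_left _ (φ * d)
      (tendsto_neg_atTop_atBot.comp (tendsto_natCast_atTop_atTop.const_mul_atTop hp))
  have h1 := h0.const_add J
  rw [add_zero] at h1
  exact ge_of_tendsto' h1 hstep2

/-- Selling when the log price passes a level `b` at which the utility is nonnegative yields at
least `U(e ^ b) e ^ (-φ (b - x))`. -/
theorem IsRegularLevy.le_sSup_expectedPayoffs [IsProbabilityMeasure P] (hY : IsRegularLevy P 𝓕 Y)
    {ρ : ℝ} (hρ0 : 0 ≤ ρ) (hρ : ρ < 1) {φ p x b : ℝ} (hφ : 0 < φ) (hp : 0 < p)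
    (hψ : laplaceExponent P Y 1 ≤ p) (hφp : laplaceExponent P Y φ = p) (hxb : x < b)
    (hb : 0 ≤ crraUtility ρ (Real.exp b)) :
    crraUtility ρ (Real.exp b) * Real.exp (-(φ * (b - x)))
      ≤ sSup (expectedPayoffs P 𝓕 Y ρ x (fun t _ => p * t)) := by
  set d := b - x with hdef
  have hd : 0 < d := sub_pos.2 hxb
  set K := crraUtility ρ (Real.exp b) with hK
  have hpos : 0 < 1 - ρ := by linarith
  have hD : IsDiscounting (Ω := Ω) p (fun t _ => p * t) := isDiscounting_const_mul le_rfl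
  set A := {ω | passageTime Y d ω ≠ ⊤} with hA
  have hmeas : MeasurableSet A := hY.measurableSet_passageTime_ne_top d
  set g : ℕ → Ω → ℝ := fun n => payoff Y ρ x (fun t _ => p * t) (gridPassage Y d n) with hg
  set e : Ω → ℝ := A.indicator fun ω => Real.exp (-(p * (passageTime Y d ω).untopA)) with he
  have hgm : ∀ n, Measurable (g n) := fun n =>
    hY.measurable_payoff hρ x hD (hY.isStoppingTime_gridPassage d n)
  have hgint : ∀ n, Integrable (g n) P := fun n =>
    hY.integrable_payoff hρ0 hρ x hp.le hψ hD (hY.isStoppingTime_gridPassage d n)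
  have hgtop : ∀ n ω, passageTime Y d ω = ⊤ → g n ω = 0 := fun n ω h =>
    payoff_of_eq_top Y ρ x _ (by rw [gridPassage, h]; rfl)
  have hgcoe : ∀ n ω, passageTime Y d ω ≠ ⊤ → g n ω =
      Real.exp (-(p * (gridTime n (passageTime Y d ω).untopA : ℝ))) *
        ((Real.exp ((1 - ρ) * (x + Y (gridTime n (passageTime Y d ω).untopA) ω)) - 1)
          / (1 - ρ)) := by
    intro n ω h
    rw [← crraUtility_exp hρ]
    refine payoff_of_eq_coe Y ρ x (fun t _ => p * t) ?_
    rw [gridPassage]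
    conv_lhs => rw [← coe_untopA h]
    rfl
  have hlow : ∀ n ω, -(1 / (1 - ρ)) ≤ g n ω := by
    intro n ω
    by_cases h : passageTime Y d ω = ⊤
    · rw [hgtop n ω h]
      exact neg_nonpos.2 (by positivity)
    · rw [hgcoe n ω h]
      set E := Real.exp (-(p * (gridTime n (passageTime Y d ω).untopA : ℝ))) with hE
      have h1 : E ≤ 1 := Real.exp_le_one_iff.2 (by
        have := mul_nonneg hp.le (gridTime n (passageTime Y d ω).untopA).coe_nonneg
        linarith)
      have h2 : 0 < E := Real.exp_pos _
      have h3 := mul_pos h2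
        (Real.exp_pos ((1 - ρ) * (x + Y (gridTime n (passageTime Y d ω).untopA) ω)))
      rw [← neg_div, mul_div_assoc']
      gcongr
      linarith
  -- The payoffs are truncated from above at their limiting bound `K`, to make them bounded.
  have hlim : Tendsto (fun n => ∫ ω, min (g n ω) K ∂P) atTop (𝓝 (∫ ω, K * e ω ∂P)) := by
    refine tendsto_integral_of_dominated_convergence (fun _ => max (1 / (1 - ρ)) K)
      (fun n => ((hgm n).min measurable_const).aestronglyMeasurable) (integrable_const _)
      (fun n => Eventually.of_forall fun ω => ?_) (Eventually.of_forall fun ω => ?_)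
    · rw [Real.norm_eq_abs, abs_le]
      constructor
      · refine le_min ((neg_le_neg (le_max_left _ _)).trans (hlow n ω)) ?_
        exact (neg_nonpos.2 (hb.trans (le_max_right _ _))).trans hb
      · exact (min_le_right _ _).trans (le_max_right _ _)
    · by_cases h : passageTime Y d ω = ⊤
      · have h1 : e ω = 0 := Set.indicator_of_notMem (by simp [hA, h]) _
        simp only [hgtop _ ω h, h1, mul_zero, min_eq_left hb]
        exact tendsto_const_nhds
      · have h1 : e ω = Real.exp (-(p * (passageTime Y d ω).untopA)) :=
          Set.indicator_of_mem (s := A) h _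
        have h2 : K * e ω = min (e ω * K) K := by
          rw [mul_comm, min_eq_left]
          refine mul_le_of_le_one_left hb ?_
          rw [h1]
          exact Real.exp_le_one_iff.2
            (neg_nonpos.2 (mul_nonneg hp.le (passageTime Y d ω).untopA.coe_nonneg))
        rw [h2]
        refine Tendsto.min ?_ tendsto_const_nhds
        simp only [hgcoe _ ω h]
        have hK' : K = (Real.exp ((1 - ρ) * (x + d)) - 1) / (1 - ρ) := by
          rw [hK, crraUtility_exp hρ, hdef, add_sub_cancel]
        rw [h1, hK']
        refine Tendsto.mul ?_ (Tendsto.div_const (Tendsto.sub_const ?_ 1) _)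
        · exact (Real.continuous_exp.tendsto _).comp ((tendsto_coe_gridTime _).const_mul p).neg
        · exact (Real.continuous_exp.tendsto _).comp
            (((hY.tendsto_apply_gridTime hd h).const_add x).const_mul _)
  have hle : ∫ ω, K * e ω ∂P ≤ sSup (expectedPayoffs P 𝓕 Y ρ x (fun t _ => p * t)) := by
    refine le_of_tendsto' hlim fun n => ?_
    refine le_trans ?_ (le_csSup (hY.bddAbove_expectedPayoffs hρ0 hρ x hp.le hψ hD)
      ⟨_, hY.isStoppingTime_gridPassage d n, rfl⟩)
    exact integral_mono ((hgint n).inf (integrable_const K)) (hgint n) fun ω => min_le_left _ _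
  refine le_trans ?_ hle
  rw [integral_const_mul]
  refine mul_le_mul_of_nonneg_left ?_ hb
  have he0 : ∀ ω, 0 ≤ e ω := fun ω => Set.indicator_nonneg (fun _ _ => (Real.exp_pos _).le) ω
  have hlint : ∫⁻ ω in A, ENNReal.ofReal (Real.exp (φ * d - p * (passageTime Y d ω).untopA)) ∂P
      = ENNReal.ofReal (Real.exp (φ * d)) * ∫⁻ ω, ENNReal.ofReal (e ω) ∂P := by
    rw [← lintegral_indicator hmeas, ← lintegral_const_mul' _ _ ENNReal.ofReal_ne_top]
    refine lintegral_congr fun ω => ?_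
    by_cases h : ω ∈ A
    · rw [he, Set.indicator_of_mem h, Set.indicator_of_mem h,
        ← ENNReal.ofReal_mul (Real.exp_pos _).le, ← Real.exp_add, sub_eq_add_neg]
    · rw [he, Set.indicator_of_notMem h, Set.indicator_of_notMem h, ENNReal.ofReal_zero, mul_zero]
  have hem : AEStronglyMeasurable e P := by
    have h1 : Tendsto (fun n => fun ω => A.indicator (fun ω =>
        Real.exp (-(p * (gridPoint n ((passageIndex Y d n ω).untopD 0) : ℝ)))) ω) atTop (𝓝 e) := by
      rw [tendsto_pi_nhds]
      intro ω
      by_cases h : ω ∈ A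
      · simp only [he, Set.indicator_of_mem h, gridPoint_passageIndex Y d _ h]
        exact (Real.continuous_exp.tendsto _).comp ((tendsto_coe_gridTime _).const_mul p).neg
      · simp only [he, Set.indicator_of_notMem h]
        exact tendsto_const_nhds
    refine (measurable_of_tendsto_metrizable (fun n => Measurable.indicator ?_ hmeas)
      h1).aestronglyMeasurable
    have h2 := (hY.isGridStopping_passageIndex d n).measurable_untopD
    exact (measurable_from_top (f := fun k : ℕ =>
      Real.exp (-(p * (gridPoint n k : ℝ))))).comp h2
  have hone := (hY.one_le_lintegral_passage hφ hp hφp hd).trans_eq hlint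
  rw [← ENNReal.ofReal_one] at hone
  have hint : Integrable e P := by
    refine Integrable.of_bound hem 1 (Eventually.of_forall fun ω => ?_)
    rw [Real.norm_eq_abs, abs_of_nonneg (he0 ω)]
    refine Set.indicator_le' (fun ω _ => ?_) (fun _ _ => zero_le_one) ω
    exact Real.exp_le_one_iff.2
      (neg_nonpos.2 (mul_nonneg hp.le (passageTime Y d ω).untopA.coe_nonneg))
  rw [← ofReal_integral_eq_lintegral_ofReal hint (Eventually.of_forall he0),
    ← ENNReal.ofReal_mul (Real.exp_pos _).le, ENNReal.ofReal_le_ofReal_iff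
      (mul_nonneg (Real.exp_pos _).le (integral_nonneg he0))] at hone
  rw [Real.exp_neg, inv_le_iff_one_le_mul₀' (Real.exp_pos _)]
  exact hone

end PassageValue

/-- The level `b` with `e ^ ((1 - ρ) b) = φ / (φ - (1 - ρ))` yields a strictly larger value of
`b ↦ U(e ^ b) e ^ (-φ b)` than any lower level `x`. -/
theorem crraUtility_lt_of_lt_threshold {ρ φ b x : ℝ} (hρ : ρ < 1) (hφ : 1 - ρ < φ)
    (hb : b = 1 / (1 - ρ) * Real.log (φ / (φ - 1 + ρ))) (hxb : x < b) :
    0 ≤ crraUtility ρ (Real.exp b) ∧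
      crraUtility ρ (Real.exp x)
        < crraUtility ρ (Real.exp b) * Real.exp (-(φ * (b - x))) := by
  set β := 1 - ρ with hβ
  have hβ0 : 0 < β := by linarith
  have hφ0 : 0 < φ := hβ0.trans hφ
  have hγ : 0 < φ - β := by linarith
  have hden : φ - 1 + ρ = φ - β := by rw [hβ]; ring
  have hexpb : Real.exp (β * b) = φ / (φ - β) := by
    rw [hb, hden, ← mul_assoc, mul_one_div_cancel hβ0.ne', one_mul, Real.exp_log (by positivity)]
  have hexpx : Real.exp (β * x) = φ / (φ - β) * Real.exp (-(β * (b - x))) := by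
    rw [← hexpb, ← Real.exp_add]
    congr 1
    ring
  have hU : crraUtility ρ (Real.exp b) = 1 / (φ - β) := by
    rw [crraUtility_exp hρ, ← hβ, hexpb]
    field_simp
    ring
  refine ⟨hU ▸ by positivity, ?_⟩
  rw [hU, crraUtility_exp hρ, ← hβ, hexpx]
  have hy : 0 < b - x := by linarith
  -- Strict convexity of `exp` between `-φ (b - x)` and `0`, with the weights `β / φ`, `1 - β / φ`.
  have hconv := strictConvexOn_exp.2 (Set.mem_univ (-(φ * (b - x)))) (Set.mem_univ 0)
    (by nlinarith : -(φ * (b - x)) ≠ 0) (show 0 < β / φ by positivity)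
    (show 0 < 1 - β / φ by rw [sub_pos, div_lt_one hφ0]; exact hφ) (by ring)
  simp only [smul_eq_mul, mul_zero, add_zero, Real.exp_zero, mul_one] at hconv
  have harg : β / φ * -(φ * (b - x)) = -(β * (b - x)) := by field_simp
  rw [harg] at hconv
  have hconv' : φ * Real.exp (-(β * (b - x)))
      < β * Real.exp (-(φ * (b - x))) + (φ - β) := by
    have := mul_lt_mul_of_pos_left hconv hφ0
    have h2 : φ * (β / φ * Real.exp (-(φ * (b - x))) + (1 - β / φ))
        = β * Real.exp (-(φ * (b - x))) + (φ - β) := by field_simp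
    rwa [h2] at this
  rw [div_lt_iff₀ hβ0, ← sub_pos]
  have hfin : 1 / (φ - β) * Real.exp (-(φ * (b - x))) * β
      - (φ / (φ - β) * Real.exp (-(β * (b - x))) - 1)
      = (β * Real.exp (-(φ * (b - x))) + (φ - β) - φ * Real.exp (-(β * (b - x)))) / (φ - β) := by
    field_simp
    ring
  rw [hfin]
  exact div_pos (by linarith) hγ

section Transfer

variable {X Y : ℝ≥0 → Ω → ℝ}

theorem omegaDiscount_congr {α : Type*} {X Y : ℝ≥0 → α → ℝ} {ω : α} (h : ∀ t, X t ω = Y t ω)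
    (r q c x s : ℝ) (t : ℝ≥0) :
    omegaDiscount X r q c x s t ω = omegaDiscount Y r q c x s t ω := by
  simp only [omegaDiscount, omegaClock, runningMax, h]
  congr!

theorem payoff_congr {α : Type*} {X Y : ℝ≥0 → α → ℝ} {ω : α} (h : ∀ t, X t ω = Y t ω)
    (ρ x : ℝ) {D D' : ℝ≥0 → α → ℝ} (hD : ∀ t, D t ω = D' t ω) (τ : α → WithTop ℝ≥0) :
    payoff X ρ x D τ ω = payoff Y ρ x D' τ ω := by
  simp only [payoff, Set.indicator_apply, stoppedValue, h, hD]

theorem expectedPayoffs_congr (𝓕 : Filtration ℝ≥0 mΩ) (h : ∀ᵐ ω ∂P, ∀ t, X t ω = Y t ω) (ρ x : ℝ)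
    {D D' : ℝ≥0 → Ω → ℝ} (hD : ∀ᵐ ω ∂P, ∀ t, D t ω = D' t ω) :
    expectedPayoffs P 𝓕 X ρ x D = expectedPayoffs P 𝓕 Y ρ x D' := by
  have h1 : ∀ τ, ∫ ω, payoff X ρ x D τ ω ∂P = ∫ ω, payoff Y ρ x D' τ ω ∂P := fun τ => by
    refine integral_congr_ae ?_
    filter_upwards [h, hD] with ω h1 h2 using payoff_congr h1 ρ x h2 τ
  simp only [expectedPayoffs, h1]

theorem laplaceExponent_congr (h : ∀ᵐ ω ∂P, ∀ t, X t ω = Y t ω) :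
    laplaceExponent P X = laplaceExponent P Y := by
  funext β
  rw [laplaceExponent, laplaceExponent, cgf, cgf, mgf_congr (by
    filter_upwards [h] with ω hω using hω 1)]

end Transfer

end OmegaSale

end

theorem proposition3p1 {Ω : Type*} [mΩ : MeasurableSpace Ω] (P : Measure Ω)
    [IsProbabilityMeasure P] (X : ℝ≥0 → Ω → ℝ)
    (hX : OmegaSale.IsSpectrallyNegativeLevy P X)
    (m σ : ℝ) (ν : Measure ℝ) (hν : OmegaSale.HasLevyTriplet P X m σ ν)
    (ρ r q : ℝ) (hρ0 : 0 ≤ ρ) (hρ1 : ρ < 1) (hr : 0 < r) (hq : 0 < q)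
    (hrψ : OmegaSale.laplaceExponent P X 1 < r)
    (𝓕 : Filtration ℝ≥0 mΩ) (h𝓕 : 𝓕 = OmegaSale.augmentedFiltration P X hX.measurable) :
    -- all expectations and suprema that occur below are well defined and finite
    (∀ x : ℝ,
      (∀ τ, IsStoppingTime 𝓕 τ →
        Integrable (OmegaSale.payoff X ρ x (fun t _ => (r + q) * t) τ) P) ∧
      BddAbove (OmegaSale.expectedPayoffs P 𝓕 X ρ x (fun t _ => (r + q) * t))) ∧
    (∀ c : ℝ, 0 < c → ∀ x s : ℝ, (x, s) ∈ OmegaSale.stateSpace →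
      (∀ τ, IsStoppingTime 𝓕 τ →
        Integrable (OmegaSale.payoff X ρ x (OmegaSale.omegaDiscount X r q c x s) τ) P) ∧
      BddAbove (OmegaSale.expectedPayoffs P 𝓕 X ρ x (OmegaSale.omegaDiscount X r q c x s))) ∧
    -- comparison of the values
    (∀ c c' : ℝ, 0 < c → c < c' → ∀ x s : ℝ, (x, s) ∈ OmegaSale.stateSpace →
      OmegaSale.constantRateValue P 𝓕 X ρ (r + q) x ≤ OmegaSale.saleValue P 𝓕 X ρ r q c x s ∧
      OmegaSale.saleValue P 𝓕 X ρ r q c x s ≤ OmegaSale.saleValue P 𝓕 X ρ r q c' x s) ∧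
    -- location of the stopping region
    (∀ c : ℝ, 0 < c →
      OmegaSale.stoppingRegion P 𝓕 X ρ r q c ⊆
        (Set.Ici (OmegaSale.lowerThreshold P X ρ (r + q)) ×ˢ
          Set.Ici (OmegaSale.lowerThreshold P X ρ (r + q))) ∩ OmegaSale.stateSpace) := by
  subst h𝓕
  obtain ⟨Y, hY, hXY⟩ := OmegaSale.exists_isRegularLevy hX hν
  have hψ : OmegaSale.laplaceExponent P X = OmegaSale.laplaceExponent P Y :=
    OmegaSale.laplaceExponent_congr hXY
  have hψr : OmegaSale.laplaceExponent P Y 1 ≤ r := by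
    rw [← hψ]
    exact hrψ.le
  have hc : ∀ x, OmegaSale.expectedPayoffs P (OmegaSale.augmentedFiltration P X hX.measurable) X ρ x
        (fun t _ => (r + q) * t)
      = OmegaSale.expectedPayoffs P (OmegaSale.augmentedFiltration P X hX.measurable) Y ρ x
        (fun t _ => (r + q) * t) := fun x =>
    OmegaSale.expectedPayoffs_congr _ hXY ρ x (Eventually.of_forall fun _ _ => rfl)
  have hv : ∀ c x s,
      OmegaSale.expectedPayoffs P (OmegaSale.augmentedFiltration P X hX.measurable) X ρ x
        (OmegaSale.omegaDiscount X r q c x s)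
      = OmegaSale.expectedPayoffs P (OmegaSale.augmentedFiltration P X hX.measurable) Y ρ x
        (OmegaSale.omegaDiscount Y r q c x s) := fun c x s =>
    OmegaSale.expectedPayoffs_congr _ hXY ρ x (by
      filter_upwards [hXY] with ω hω t using OmegaSale.omegaDiscount_congr hω r q c x s t)
  have hDc : OmegaSale.IsDiscounting (Ω := Ω) r (fun t _ => (r + q) * t) :=
    OmegaSale.isDiscounting_const_mul (by linarith)
  have hDv : ∀ c x s, OmegaSale.IsDiscounting r (OmegaSale.omegaDiscount Y r q c x s) :=
    fun c x s => ⟨hY.measurable_omegaDiscount r q c x s,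
      OmegaSale.le_omegaDiscount Y hq.le r c x s⟩
  have hcomp : ∀ c x s,
      OmegaSale.constantRateValue P (OmegaSale.augmentedFiltration P X hX.measurable) X ρ (r + q) x
      ≤ OmegaSale.saleValue P (OmegaSale.augmentedFiltration P X hX.measurable) X ρ r q c x s := by
    intro c x s
    rw [OmegaSale.constantRateValue, OmegaSale.saleValue, hc, hv]
    exact hY.sSup_expectedPayoffs_mono hρ0 hρ1 x hr.le hψr hDc (hDv c x s)
      (hY.omegaDiscount_le hq.le r c x s)
  refine ⟨fun x => ⟨fun τ hτ => ?_, ?_⟩, fun c _ x s _ => ⟨fun τ hτ => ?_, ?_⟩,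
    fun c c' _ hcc' x s _ => ⟨hcomp c x s, ?_⟩, fun c _ => ?_⟩
  · refine (hY.integrable_payoff hρ0 hρ1 x hr.le hψr hDc hτ).congr ?_
    filter_upwards [hXY] with ω hω
    exact (OmegaSale.payoff_congr hω ρ x (fun _ => rfl) τ).symm
  · rw [hc]
    exact hY.bddAbove_expectedPayoffs hρ0 hρ1 x hr.le hψr hDc
  · refine (hY.integrable_payoff hρ0 hρ1 x hr.le hψr (hDv c x s) hτ).congr ?_
    filter_upwards [hXY] with ω hω
    exact (OmegaSale.payoff_congr hω ρ x (OmegaSale.omegaDiscount_congr hω r q c x s) τ).symm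
  · rw [hv]
    exact hY.bddAbove_expectedPayoffs hρ0 hρ1 x hr.le hψr (hDv c x s)
  · rw [OmegaSale.saleValue, OmegaSale.saleValue, hv, hv]
    exact hY.sSup_expectedPayoffs_mono hρ0 hρ1 x hr.le hψr (hDv c x s) (hDv c' x s)
      (hY.omegaDiscount_anti hq.le hcc'.le r x s)
  · rintro ⟨x, s⟩ ⟨hxs, hVU⟩
    change x ≤ s at hxs
    -- As `x ≤ s`, only the bound on `x` matters; below the threshold the value exceeds `U(e ^ x)`.
    suffices h : OmegaSale.lowerThreshold P X ρ (r + q) ≤ x from ⟨⟨h, h.trans hxs⟩, hxs⟩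
    by_contra hlt
    rw [not_le] at hlt
    obtain ⟨hΦ, hΦ1⟩ := hY.rightInverse_spec (p := r + q) (by linarith)
    have hΦX : OmegaSale.rightInverse P X (r + q) = OmegaSale.rightInverse P Y (r + q) := by
      rw [OmegaSale.rightInverse, hψ, OmegaSale.rightInverse]
    obtain ⟨hU, hUlt⟩ := OmegaSale.crraUtility_lt_of_lt_threshold hρ1
      (show 1 - ρ < OmegaSale.rightInverse P Y (r + q) by linarith)
      (by rw [OmegaSale.lowerThreshold, hΦX]) hlt
    have hpass := hY.le_sSup_expectedPayoffs hρ0 hρ1 (zero_lt_one.trans hΦ1)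
      (show 0 < r + q by linarith) (by linarith) hΦ hlt hU
    rw [← hc x] at hpass
    have h1 := hcomp c x s
    rw [OmegaSale.constantRateValue] at h1
    have hVeq : OmegaSale.saleValue P (OmegaSale.augmentedFiltration P X hX.measurable) X ρ r q c
      x s - OmegaSale.crraUtility ρ (Real.exp x) = 0 := hVU
    linarith
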